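/- Let $\lambda(\xi)=\frac{\xi+\sqrt{\xi^2+4}}{2}$ for $\xi\in\mathbb{R}$. Let $x_1,\dots,x_n\in\mathbb{R}^p$ be known vectors, $X=(x_1,\dots,x_n)^\top$, and let $n_1,\dots,n_n>0$ be known real numbers. Consider the Poisson regression model in which, given $\beta\in\mathbb{R}^p$, the observations $y_1,\dots,y_n$ are independent with $y_i\sim\mathrm{Po}\bigl(n_i\,\lambda(x_i^\top\beta)\bigr)$, with prior $\beta\sim\mathrm{N}_p(\mu,\Psi^{-1})$, where $\mu\in\mathbb{R}^p$ and $\Psi$ is a symmetric positive definite $p\times p$ matrix. Fix the observed $y=(y_i)_{i=1}^n$. Consider the Markov chain on $\mathbb{R}^p$ that moves from $\beta$ to a new $\beta'$ as follows. Put $\beta_i=x_i^\top\beta$. Independently for $i=1,\dots,n$, draw $u_i\sim\mathrm{Ga}\bigl(y_i,\,-\beta_i+\sqrt{\beta_i^2+4}\bigr)$ (shape, rate); then, given $u_i$, draw $v_i\sim\mathrm{IGauss}\bigl(1/\{(n_i/2+u_i)\sqrt{\beta_i^2+4}\},\,1\bigr)$, where $\mathrm{IGauss}(m,s)$ has density $\sqrt{\tfrac{s}{2\pi}}\,e^{s/m}\,v^{-3/2}\exp\{-\tfrac12(\tfrac{s}{m^2}v+\tfrac{s}{v})\}$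 on $(0,\infty)$; and let $w_i=v_i(n_i/2+u_i)^2$. With $W=\mathrm{diag}(w_1,\dots,w_n)$, $u=(u_i)_{i=1}^n$ and $\mathbf{n}=(n_i)_{i=1}^n$, draw $$\beta'\sim\mathrm{N}_p\bigl((\Psi+X^\top WX)^{-1}\{\Psi\mu+X^\top(u-\mathbf{n}/2)\},\;(\Psi+X^\top WX)^{-1}\bigr).$$ Let $P$ be the transition kernel of this chain, $P^m$ the $m$-step transition kernel, and $\pi$ the posterior distribution of $\beta$ given $y$. Assume that $y_i\ge 1$ for all $i=1,\dots,n$ and that $X^\top X$ has full rank. Then the chain is geometrically ergodic: $\pi$ is an invariant probability distribution of $P$, and there are a constant $0<\rho<1$ and a function $M\colon\mathbb{R}^p\to[0,\infty)$ such that $$\sup_{A\subseteq\mathbb{R}^p\text{ Borel}}\bigl|P^m(\beta,A)-\pi(A)\bigr|\le M(\beta)\,\rho^m\qquad\text{for all }\beta\in\mathbb{R}^p\text{ and all integers }m\ge 0.$$ -/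

import Mathlib

open MeasureTheory ProbabilityTheory Matrix
open scoped ENNReal

noncomputable section

namespace PoissonGibbs

/-- The link function `λ(ξ) = (ξ + √(ξ² + 4)) / 2`. -/
def link (ξ : ℝ) : ℝ := (ξ + √(ξ ^ 2 + 4)) / 2

/-- Density, with respect to Lebesgue measure on `ℝ`, of the inverse Gaussian distribution with
mean parameter `m` and shape parameter `s`. -/
def invGaussPDF (m s v : ℝ) : ℝ≥0∞ :=
  ENNReal.ofReal (if 0 < v then
    √(s / (2 * Real.pi)) * Real.exp (s / m) * (1 / v ^ (3 / 2 : ℝ)) *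
      Real.exp (-(1 / 2) * (s / m ^ 2 * v + s / v))
    else 0)

/-- Density, with respect to Lebesgue measure on `ℝ^p`, of the normal distribution
`N_p(a, Q⁻¹)` with mean vector `a` and precision matrix `Q` (positive definite). -/
def normalPDF {p : ℕ} (a : Fin p → ℝ) (Q : Matrix (Fin p) (Fin p) ℝ) (β : Fin p → ℝ) : ℝ≥0∞ :=
  ENNReal.ofReal (√(Q.det / (2 * Real.pi) ^ p) *
    Real.exp (-(1 / 2) * ((β - a) ⬝ᵥ (Q *ᵥ (β - a)))))

/-- The likelihood of `β` in the Poisson regression model: the `y i` are independent and Poisson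
distributed with means `N i * link (x_iᵀ β)`, where `x_iᵀ` is the `i`-th row of `X`. -/
def likelihood {n p : ℕ} (X : Matrix (Fin n) (Fin p) ℝ) (N : Fin n → ℝ) (y : Fin n → ℕ)
    (β : Fin p → ℝ) : ℝ≥0∞ :=
  ∏ i, poissonMeasure (Real.toNNReal (N i * link ((X *ᵥ β) i))) {y i}

/-- The posterior distribution of `β` given `y`, under the prior `N_p(μ, Ψ⁻¹)`: the probability
measure whose density is proportional to prior density times likelihood. -/
def posterior {n p : ℕ} (X : Matrix (Fin n) (Fin p) ℝ) (N : Fin n → ℝ) (y : Fin n → ℕ)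
    (μ : Fin p → ℝ) (Ψ : Matrix (Fin p) (Fin p) ℝ) : Measure (Fin p → ℝ) :=
  (∫⁻ β, normalPDF μ Ψ β * likelihood X N y β)⁻¹ •
    volume.withDensity fun β => normalPDF μ Ψ β * likelihood X N y β

/-- Conditional density of the latent variables `z = (u, v)` given `β` (for `y i ≥ 1`):
independently over `i`, `u i ∼ Ga(y i, -β_i + √(β_i² + 4))` (shape, rate) and, given `u i`,
`v i ∼ IGauss(1 / ((N i / 2 + u i) √(β_i² + 4)), 1)`, where `β_i = x_iᵀ β`. -/
def latentPDF {n p : ℕ} (X : Matrix (Fin n) (Fin p) ℝ) (N : Fin n → ℝ) (y : Fin n → ℕ)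
    (β : Fin p → ℝ) (z : (Fin n → ℝ) × (Fin n → ℝ)) : ℝ≥0∞ :=
  ∏ i, (gammaPDF (y i) (-(X *ᵥ β) i + √((X *ᵥ β) i ^ 2 + 4)) (z.1 i) *
    invGaussPDF (1 / ((N i / 2 + z.1 i) * √((X *ᵥ β) i ^ 2 + 4))) 1 (z.2 i))

/-- The weights `w i = v i * (N i / 2 + u i)²`. -/
def weight {n : ℕ} (N : Fin n → ℝ) (z : (Fin n → ℝ) × (Fin n → ℝ)) : Fin n → ℝ :=
  fun i => z.2 i * (N i / 2 + z.1 i) ^ 2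

/-- The precision matrix `Ψ + Xᵀ W X`, with `W = diag(w)`. -/
def condPrec {n p : ℕ} (X : Matrix (Fin n) (Fin p) ℝ) (N : Fin n → ℝ)
    (Ψ : Matrix (Fin p) (Fin p) ℝ) (z : (Fin n → ℝ) × (Fin n → ℝ)) : Matrix (Fin p) (Fin p) ℝ :=
  Ψ + Xᵀ * diagonal (weight N z) * X

/-- The mean vector `(Ψ + Xᵀ W X)⁻¹ (Ψ μ + Xᵀ (u - N / 2))`. -/
def condMean {n p : ℕ} (X : Matrix (Fin n) (Fin p) ℝ) (N : Fin n → ℝ) (μ : Fin p → ℝ)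
    (Ψ : Matrix (Fin p) (Fin p) ℝ) (z : (Fin n → ℝ) × (Fin n → ℝ)) : Fin p → ℝ :=
  (condPrec X N Ψ z)⁻¹ *ᵥ (Ψ *ᵥ μ + Xᵀ *ᵥ (fun i => z.1 i - N i / 2))

/-- Conditional density of `β` given the latent variables `z = (u, v)`. -/
def coefPDF {n p : ℕ} (X : Matrix (Fin n) (Fin p) ℝ) (N : Fin n → ℝ) (μ : Fin p → ℝ)
    (Ψ : Matrix (Fin p) (Fin p) ℝ) (z : (Fin n → ℝ) × (Fin n → ℝ)) (β : Fin p → ℝ) : ℝ≥0∞ :=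
  normalPDF (condMean X N μ Ψ z) (condPrec X N Ψ z) β

/-- The step of the sampler that draws the latent variables `(u, v)` given `β`. -/
def latentKernel {n p : ℕ} (X : Matrix (Fin n) (Fin p) ℝ) (N : Fin n → ℝ) (y : Fin n → ℕ) :
    Kernel (Fin p → ℝ) ((Fin n → ℝ) × (Fin n → ℝ)) :=
  (Kernel.const (Fin p → ℝ) volume).withDensity (latentPDF X N y)

/-- The step of the sampler that draws `β` given the latent variables `(u, v)`. -/
def coefKernel {n p : ℕ} (X : Matrix (Fin n) (Fin p) ℝ) (N : Fin n → ℝ) (μ : Fin p → ℝ)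
    (Ψ : Matrix (Fin p) (Fin p) ℝ) : Kernel ((Fin n → ℝ) × (Fin n → ℝ)) (Fin p → ℝ) :=
  (Kernel.const ((Fin n → ℝ) × (Fin n → ℝ)) volume).withDensity (coefPDF X N μ Ψ)

/-- One sweep of the Gibbs sampler: the transition kernel of the Markov chain on `β`. -/
def gibbsKernel {n p : ℕ} (X : Matrix (Fin n) (Fin p) ℝ) (N : Fin n → ℝ) (y : Fin n → ℕ)
    (μ : Fin p → ℝ) (Ψ : Matrix (Fin p) (Fin p) ℝ) : Kernel (Fin p → ℝ) (Fin p → ℝ) :=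
  coefKernel X N μ Ψ ∘ₖ latentKernel X N y

/-- Total variation distance `sup_A |P(A) - Q(A)|` over measurable sets `A`. -/
def tvDist {α : Type*} [MeasurableSpace α] (P Q : Measure α) : ℝ :=
  ⨆ A : {A : Set α // MeasurableSet A}, |P.real A - Q.real A|

/-- Geometric ergodicity of the Markov chain with transition kernel `κ` and invariant
distribution `π`: from every starting point `x`, the law of the chain after `m` steps converges
to `π` in total variation at a geometric rate, with a finite constant depending on `x`. Here
`κ ^ m` is the `m`-step transition kernel. -/
def GeometricallyErgodic {α : Type*} [MeasurableSpace α] (κ : Kernel α α) (π : Measure α) : Prop :=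
  IsMarkovKernel κ ∧ IsProbabilityMeasure π ∧ κ.Invariant π ∧
    ∃ ρ : ℝ, 0 < ρ ∧ ρ < 1 ∧ ∃ M : α → ℝ, (∀ x, 0 ≤ M x) ∧
      ∀ (m : ℕ) (x : α), tvDist ((κ ^ m) x) π ≤ M x * ρ ^ m

/-! The densities are jointly measurable, so that the two kernels are given by them. -/

theorem measurable_gammaPDF₂ (a : ℝ) : Measurable fun q : ℝ × ℝ => gammaPDF a q.1 q.2 := by
  unfold gammaPDF gammaPDFReal
  refine ENNReal.measurable_ofReal.comp (Measurable.ite ?_ (by fun_prop) (by fun_prop))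
  exact measurableSet_le measurable_const measurable_snd

theorem measurable_invGaussPDF₂ (s : ℝ) : Measurable fun q : ℝ × ℝ => invGaussPDF q.1 s q.2 := by
  unfold invGaussPDF
  refine ENNReal.measurable_ofReal.comp (Measurable.ite ?_ (by fun_prop) (by fun_prop))
  exact measurableSet_lt measurable_const measurable_snd

theorem measurable_latentPDF {n p : ℕ} (X : Matrix (Fin n) (Fin p) ℝ) (N : Fin n → ℝ)
    (y : Fin n → ℕ) : Measurable (Function.uncurry (latentPDF X N y)) := by
  unfold latentPDF Function.uncurry
  have hX : ∀ i, Measurable fun q : (Fin p → ℝ) × ((Fin n → ℝ) × (Fin n → ℝ)) =>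
      (X *ᵥ q.1) i := by
    intro i; simp only [mulVec, dotProduct]; fun_prop
  refine Finset.measurable_prod _ fun i _ => ?_
  have hXi := hX i
  have h1 : Measurable fun q : (Fin p → ℝ) × ((Fin n → ℝ) × (Fin n → ℝ)) =>
      gammaPDF (y i) (-(X *ᵥ q.1) i + √((X *ᵥ q.1) i ^ 2 + 4)) (q.2.1 i) :=
    (measurable_gammaPDF₂ (y i)).comp (Measurable.prodMk (by fun_prop) (by fun_prop))
  have h2 : Measurable fun q : (Fin p → ℝ) × ((Fin n → ℝ) × (Fin n → ℝ)) =>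
      invGaussPDF (1 / ((N i / 2 + q.2.1 i) * √((X *ᵥ q.1) i ^ 2 + 4))) 1 (q.2.2 i) :=
    (measurable_invGaussPDF₂ 1).comp (Measurable.prodMk (by fun_prop) (by fun_prop))
  exact h1.mul h2

theorem continuous_condPrec {n p : ℕ} (X : Matrix (Fin n) (Fin p) ℝ) (N : Fin n → ℝ)
    (Ψ : Matrix (Fin p) (Fin p) ℝ) : Continuous (condPrec X N Ψ) := by
  unfold condPrec weight
  have : Continuous fun z : (Fin n → ℝ) × (Fin n → ℝ) =>
      diagonal (fun i => z.2 i * (N i / 2 + z.1 i) ^ 2) :=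
    Continuous.matrix_diagonal (by fun_prop)
  exact continuous_const.add ((continuous_const.matrix_mul this).matrix_mul continuous_const)

theorem measurable_condMean {n p : ℕ} (X : Matrix (Fin n) (Fin p) ℝ) (N : Fin n → ℝ)
    (μ : Fin p → ℝ) (Ψ : Matrix (Fin p) (Fin p) ℝ) : Measurable (condMean X N μ Ψ) := by
  refine measurable_pi_lambda _ fun k => ?_
  have hd : Measurable fun z => ((condPrec X N Ψ z).det)⁻¹ :=
    (continuous_condPrec X N Ψ).matrix_det.measurable.inv
  have ha : ∀ j, Measurable fun z => (condPrec X N Ψ z).adjugate k j := fun j =>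
    ((continuous_condPrec X N Ψ).matrix_adjugate.matrix_elem k j).measurable
  have hi : ∀ j, Measurable fun z => (condPrec X N Ψ z)⁻¹ k j := fun j => by
    simp only [inv_def, Ring.inverse_eq_inv', Matrix.smul_apply, smul_eq_mul]
    exact hd.mul (ha j)
  unfold condMean
  simp only [mulVec, dotProduct, Pi.add_apply]
  refine Finset.measurable_sum _ fun j _ => (hi j).mul (measurable_const.add ?_)
  fun_prop

theorem measurable_coefPDF {n p : ℕ} (X : Matrix (Fin n) (Fin p) ℝ) (N : Fin n → ℝ)
    (μ : Fin p → ℝ) (Ψ : Matrix (Fin p) (Fin p) ℝ) :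
    Measurable (Function.uncurry (coefPDF X N μ Ψ)) := by
  have hd : Measurable fun q : ((Fin n → ℝ) × (Fin n → ℝ)) × (Fin p → ℝ) =>
      (condPrec X N Ψ q.1).det :=
    (continuous_condPrec X N Ψ).matrix_det.measurable.comp measurable_fst
  have hQ : ∀ i j, Measurable fun q : ((Fin n → ℝ) × (Fin n → ℝ)) × (Fin p → ℝ) =>
      condPrec X N Ψ q.1 i j := fun i j =>
    ((continuous_condPrec X N Ψ).matrix_elem i j).measurable.comp measurable_fst
  have hm : ∀ i, Measurable fun q : ((Fin n → ℝ) × (Fin n → ℝ)) × (Fin p → ℝ) =>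
      q.2 i - condMean X N μ Ψ q.1 i := fun i =>
    ((measurable_pi_apply i).comp measurable_snd).sub
      (((measurable_pi_apply i).comp (measurable_condMean X N μ Ψ)).comp measurable_fst)
  unfold coefPDF normalPDF Function.uncurry
  simp only [mulVec, dotProduct, Pi.sub_apply]
  refine ENNReal.measurable_ofReal.comp (Measurable.mul (by fun_prop) ?_)
  refine Real.measurable_exp.comp (measurable_const.mul ?_)
  exact Finset.measurable_sum _ fun i _ => (hm i).mul
    (Finset.measurable_sum _ fun j _ => (hQ i j).mul (hm j))

theorem latentKernel_apply {n p : ℕ} (X : Matrix (Fin n) (Fin p) ℝ) (N : Fin n → ℝ)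
    (y : Fin n → ℕ) (β : Fin p → ℝ) :
    latentKernel X N y β = volume.withDensity (latentPDF X N y β) := by
  rw [latentKernel, Kernel.withDensity_apply _ (measurable_latentPDF X N y), Kernel.const_apply]

theorem coefKernel_apply {n p : ℕ} (X : Matrix (Fin n) (Fin p) ℝ) (N : Fin n → ℝ)
    (μ : Fin p → ℝ) (Ψ : Matrix (Fin p) (Fin p) ℝ) (z : (Fin n → ℝ) × (Fin n → ℝ)) :
    coefKernel X N μ Ψ z = volume.withDensity (coefPDF X N μ Ψ z) := by
  rw [coefKernel, Kernel.withDensity_apply _ (measurable_coefPDF X N μ Ψ), Kernel.const_apply]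

end PoissonGibbs

end

namespace PoissonGibbs

/-! ### Drift and minorization imply geometric ergodicity -/

section Harris

/-! The chain satisfies a drift and a minorization condition for `V β = √(βᵀ Ψ β)`, so Harris'
ergodic theorem applies; it is proved here by contracting a weighted oscillation seminorm.

Drift. Write `ξ = x_iᵀ β`, `s = √(ξ² + 4)`, `c = N i / 2 + u i`. Given `u i`, the weight `w i` has
mean `c / s`, so `u i - w i ξ` is centred up to terms whose expectation is bounded in `β`: a large
mean of `u i` is compensated by the factor `(s - ξ) / s`. Hence both `E[w i]` and `E|u i - w i ξ|`
are bounded uniformly in `β` (`lintegral_weight_mul_sitePDF_le`, `lintegral_error_mul_sitePDF_le`).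
With `Q = Ψ + Xᵀ W X`, the conditional mean is `Q⁻¹ Xᵀ W X β` plus `Q⁻¹` applied to `Ψ μ` and `Xᵀ`
of these errors and `N / 2`. The first term shrinks the `Ψ`-norm by `a / (1 + a)`, where `a` is a
multiple of `∑ w i` (`wnorm_solution_le_shrink`); the second is controlled because `Q ≥ Ψ`
(`wnorm_solution_le`). As `a / (1 + a)` is concave, a bound `A` on the mean of `a` gives the rate `A
/ (1 + A) < 1` (`exists_drift`). The Gaussian noise adds a constant, again since `Q ≥ Ψ`.

Minorization. On a sublevel set of `V` all `x_iᵀ β` are bounded, so the density of `(u, v)` is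
bounded below on a fixed box; pushing the uniform measure on that box through the Gaussian step
gives a common minorant (`exists_minorization`).

Invariance. Prior times likelihood times the density of `(u, v)` is, as a function of `β`, a
multiple of the Gaussian density that the second step draws from, because all square roots cancel
(`poisson_mul_sitePDF`, `complete_square`). The posterior is thus the `β`-marginal of a two-block
Gibbs sampler (`invariant_posterior`). -/

/-- A weighted oscillation bound becomes a weighted sup bound after subtracting a constant; the
supremum of `φ - g` serves as the constant. -/
theorem exists_center {α : Type*} {φ g : α → ℝ} (h : ∀ x y, φ x - φ y ≤ g x + g y) :
    ∃ c, ∀ x, |φ x - c| ≤ g x := by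
  rcases isEmpty_or_nonempty α with he | ⟨⟨x₀⟩⟩
  · exact ⟨0, fun x => he.elim x⟩
  have hb : BddAbove (Set.range fun x => φ x - g x) :=
    ⟨φ x₀ + g x₀, by rintro _ ⟨x, rfl⟩; have := h x x₀; simp only; linarith⟩
  refine ⟨⨆ x, (φ x - g x), fun x => abs_sub_le_iff.2 ⟨?_, ?_⟩⟩
  · have := le_ciSup hb x
    linarith
  · have : Nonempty α := ⟨x₀⟩
    have : (⨆ y, (φ y - g y)) ≤ φ x + g x := ciSup_le fun y => by have := h y x; linarith
    linarith

variable {α : Type*} [MeasurableSpace α]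

theorem integrable_of_lintegral_ofReal_le {V : α → ℝ} (hVm : Measurable V) (hV0 : ∀ x, 0 ≤ V x)
    {m : Measure α} {r : ℝ} (hr : 0 ≤ r) (h : ∫⁻ y, ENNReal.ofReal (V y) ∂m ≤ ENNReal.ofReal r) :
    Integrable V m ∧ ∫ y, V y ∂m ≤ r := by
  refine ⟨⟨hVm.aestronglyMeasurable, ?_⟩, ?_⟩
  · rw [hasFiniteIntegral_iff_ofReal (Filter.Eventually.of_forall hV0)]
    exact h.trans_lt ENNReal.ofReal_lt_top
  · rw [integral_eq_lintegral_of_nonneg_ae (Filter.Eventually.of_forall hV0)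
      hVm.aestronglyMeasurable]
    exact ENNReal.toReal_le_of_le_ofReal hr h

theorem abs_integral_le_of_weight {V g : α → ℝ} {m : Measure α} [IsFiniteMeasure m] {K θ r : ℝ}
    (hK : 0 ≤ K) (hθ : 0 ≤ θ) (hV : Integrable V m) (hVr : ∫ y, V y ∂m ≤ r)
    (hg : ∀ x, |g x| ≤ K * (1 + θ * V x)) :
    |∫ y, g y ∂m| ≤ K * (m.real Set.univ + θ * r) := by
  calc |∫ y, g y ∂m| ≤ ∫ y, K * (1 + θ * V y) ∂m := by
        rw [← Real.norm_eq_abs]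
        exact norm_integral_le_of_norm_le (((integrable_const 1).add (hV.const_mul θ)).const_mul K)
          (Filter.Eventually.of_forall fun x => hg x)
    _ = K * (m.real Set.univ + θ * ∫ y, V y ∂m) := by
        rw [integral_const_mul, integral_add (integrable_const 1) (hV.const_mul θ),
          integral_const_mul]
        simp
    _ ≤ K * (m.real Set.univ + θ * r) := by gcongr

/-- One step of the chain contracts the oscillation of bounded functions, measured with the weight
`1 + θ V`. -/
theorem abs_integral_sub_le (κ : Kernel α α) [IsMarkovKernel κ] {V : α → ℝ} (hVm : Measurable V)
    (hV0 : ∀ x, 0 ≤ V x) {γ b R θ a ρ : ℝ} (hγ0 : 0 ≤ γ) (hb : 0 ≤ b) (hθ : 0 ≤ θ)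
    (drift : ∀ x, ∫⁻ y, ENNReal.ofReal (V y) ∂(κ x) ≤ ENNReal.ofReal (γ * V x + b))
    {ν : Measure α} [IsFiniteMeasure ν] (hν : ∀ x, V x ≤ R → ν ≤ κ x) (hνa : ν.real Set.univ = a)
    (hθa : 2 * θ * b ≤ a) (hρ1 : 1 - a / 2 ≤ ρ) (hργ : γ ≤ ρ)
    (hρR : ∀ S, R ≤ S → 2 + θ * γ * S + 2 * θ * b ≤ ρ * (2 + θ * S))
    {φ : α → ℝ} (hφm : Measurable φ) {B : ℝ} (hφB : ∀ x, |φ x| ≤ B) {K : ℝ} (hK : 0 ≤ K)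
    (hφ : ∀ x y, φ x - φ y ≤ K * (2 + θ * V x + θ * V y)) (x y : α) :
    |∫ z, φ z ∂(κ x) - ∫ z, φ z ∂(κ y)| ≤ ρ * K * (2 + θ * V x + θ * V y) := by
  -- Subtracting `c` does not change the difference of integrals, and makes the weighted bound
  -- usable under each measure separately.
  obtain ⟨c, hc⟩ := exists_center (φ := φ) (g := fun x => K * (1 + θ * V x))
    (fun x y => (hφ x y).trans (by linarith))
  have hbdi : ∀ m : Measure α, IsFiniteMeasure m → Integrable (fun z => φ z - c) m := by
    intro m _
    refine (Integrable.of_bound hφm.aestronglyMeasurable B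
      (Filter.Eventually.of_forall hφB)).sub (integrable_const c)
  have hφi : ∀ x, ∫ z, φ z ∂(κ x) = ∫ z, (φ z - c) ∂(κ x) + c := by
    intro x
    rw [integral_sub (Integrable.of_bound hφm.aestronglyMeasurable B
      (Filter.Eventually.of_forall hφB)) (integrable_const c)]
    simp
  have hd : ∀ x, 0 ≤ γ * V x + b := fun x => add_nonneg (mul_nonneg hγ0 (hV0 x)) hb
  have hVi := fun x => integrable_of_lintegral_ofReal_le hVm hV0 (hd x) (drift x)
  rw [hφi x, hφi y, add_sub_add_right_eq_sub]
  -- Far out, the drift alone contracts. Otherwise both points lie in the sublevel set, the common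
  -- part `ν` cancels, and only remainders of mass `1 - a` contribute.
  by_cases hxy : R ≤ V x + V y
  · have h1 := fun x => abs_integral_le_of_weight hK hθ (hVi x).1 (hVi x).2 hc
    have h2 := mul_le_mul_of_nonneg_left (hρR _ hxy) hK
    have hx := h1 x
    have hy := h1 y
    simp only [probReal_univ] at hx hy
    refine (abs_sub _ _).trans ?_
    nlinarith
  · push Not at hxy
    have key : ∀ x, V x ≤ R → ∃ q, ∫ z, (φ z - c) ∂(κ x) = ∫ z, (φ z - c) ∂ν + q ∧
        |q| ≤ K * (1 - a + θ * (γ * V x + b)) := by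
      intro x hx
      have hle := hν x hx
      have hadd : κ x - ν + ν = κ x := Measure.sub_add_cancel_of_le hle
      have hle' : κ x - ν ≤ κ x := Measure.sub_le
      have hfin : IsFiniteMeasure (κ x - ν) := inferInstance
      refine ⟨∫ z, (φ z - c) ∂(κ x - ν), ?_, ?_⟩
      · conv_lhs => rw [← hadd]
        rw [integral_add_measure (hbdi _ inferInstance) (hbdi _ inferInstance), add_comm]
      · have h3 : ∫ z, V z ∂(κ x - ν) ≤ γ * V x + b :=
          (integral_mono_measure hle' (Filter.Eventually.of_forall hV0) (hVi x).1).trans (hVi x).2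
        have h4 := abs_integral_le_of_weight hK hθ ((hVi x).1.mono_measure hle') h3 hc
        have h5 : (κ x - ν).real Set.univ = 1 - a := by
          have : (κ x - ν + ν).real Set.univ = 1 := by rw [hadd]; simp
          rw [measureReal_add_apply, hνa] at this
          linarith
        rwa [h5] at h4
    obtain ⟨q, hq, hq'⟩ := key x (by linarith [hV0 y])
    obtain ⟨r, hr, hr'⟩ := key y (by linarith [hV0 x])
    rw [hq, hr, add_sub_add_left_eq_sub]
    refine (abs_sub _ _).trans ?_
    have h6 : 2 * (1 - a) + θ * (γ * V x + b) + θ * (γ * V y + b) ≤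
        ρ * (2 + θ * V x + θ * V y) := by
      have := mul_le_mul_of_nonneg_right hργ (mul_nonneg hθ (hV0 x))
      have := mul_le_mul_of_nonneg_right hργ (mul_nonneg hθ (hV0 y))
      nlinarith
    have h7 := mul_le_mul_of_nonneg_left h6 hK
    nlinarith

theorem isMarkovKernel_pow (κ : Kernel α α) [IsMarkovKernel κ] (m : ℕ) :
    IsMarkovKernel (κ ^ m) := by
  induction m with
  | zero => rw [pow_zero]; exact inferInstanceAs (IsMarkovKernel Kernel.id)
  | succ m ih => rw [pow_succ]; exact inferInstanceAs (IsMarkovKernel ((κ ^ m) ∘ₖ κ))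

theorem invariant_pow {κ : Kernel α α} {π : Measure α} (h : κ.Invariant π) (m : ℕ) :
    (κ ^ m).Invariant π := by
  induction m with
  | zero => rw [pow_zero]; exact Measure.id_comp
  | succ m ih => rw [pow_succ]; exact ih.comp h

/-- The **Harris ergodic theorem**: a drift condition together with a minorization condition on the sublevel
sets of the drift function gives geometric ergodicity. -/
theorem geometricallyErgodic_of_drift_of_minorization (κ : Kernel α α) [IsMarkovKernel κ]
    (π : Measure α) [IsProbabilityMeasure π] (hinv : κ.Invariant π) {V : α → ℝ}
    (hVm : Measurable V) (hV0 : ∀ x, 0 ≤ V x) {γ b : ℝ} (hγ0 : 0 ≤ γ) (hγ1 : γ < 1) (hb : 0 ≤ b)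
    (drift : ∀ x, ∫⁻ y, ENNReal.ofReal (V y) ∂(κ x) ≤ ENNReal.ofReal (γ * V x + b))
    (hVπ : ∫⁻ y, ENNReal.ofReal (V y) ∂π ≠ ∞)
    (minor : ∀ R, ∃ ν : Measure α, IsFiniteMeasure ν ∧ ν Set.univ ≠ 0 ∧ ∀ x, V x ≤ R → ν ≤ κ x) :
    GeometricallyErgodic κ π := by
  refine ⟨inferInstance, inferInstance, hinv, ?_⟩
  -- With this `R`, `γ S + 2 b ≤ δ S` for `S ≥ R`, where `δ = (1 + γ) / 2`: half of the drift gap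
  -- absorbs the constants.
  set R : ℝ := 4 * b / (1 - γ) + 1 with hRdef
  have hg : 0 < 1 - γ := by linarith
  have hR : 0 < R := by positivity
  have hRb : 4 * b ≤ (1 - γ) * R := by rw [hRdef]; field_simp; linarith
  obtain ⟨ν, hνf, hν0, hν⟩ := minor R
  set a := ν.real Set.univ with ha
  have ha0 : 0 < a := ENNReal.toReal_pos hν0 (measure_ne_top ν _)
  -- `V` is weighted so lightly that `2 θ b` costs at most half of the mass `2 a` gained by
  -- cancellation; `b + 1` keeps the quotient meaningful for `b = 0`.
  set θ : ℝ := a / (2 * (b + 1)) with hθdef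
  have hθ : 0 < θ := by positivity
  have hθa : 2 * θ * b ≤ a := by
    rw [hθdef]
    have : 2 * (a / (2 * (b + 1))) * b = a * (b / (b + 1)) := by field_simp
    rw [this]
    exact mul_le_of_le_one_right ha0.le (div_le_one_of_le₀ (by linarith) (by linarith))
  set δ : ℝ := (1 + γ) / 2 with hδ
  -- `(2 + θ δ S) / (2 + θ S)` decreases in `S`, so its value at `R` is the worst rate over `S ≥ R`.
  set γ₁ : ℝ := (2 + θ * δ * R) / (2 + θ * R) with hγ₁
  have hθR : 0 < θ * R := by positivity
  have hγ₁0 : 0 < γ₁ := by positivity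
  have hγ₁1 : γ₁ < 1 := by
    rw [hγ₁, div_lt_one (by positivity)]
    nlinarith
  have hδγ₁ : δ ≤ γ₁ := by
    rw [hγ₁, le_div_iff₀ (by positivity)]
    nlinarith
  have hγ₁e : γ₁ * (2 + θ * R) = 2 + θ * δ * R := by rw [hγ₁]; field_simp
  set ρ : ℝ := max γ₁ (max (1 - a / 2) γ) with hρ
  have hρ0 : 0 < ρ := lt_max_of_lt_left hγ₁0
  have hρ1 : ρ < 1 := max_lt hγ₁1 (max_lt (by linarith) hγ1)
  have hρR : ∀ S, R ≤ S → 2 + θ * γ * S + 2 * θ * b ≤ ρ * (2 + θ * S) := by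
    intro S hS
    have h1 : 2 * b ≤ (1 - γ) / 2 * S := by nlinarith
    have h2 : 2 * θ * b ≤ θ * ((1 - γ) / 2 * S) := by nlinarith
    have h3 : θ * δ * (S - R) ≤ γ₁ * (θ * (S - R)) := by
      have := mul_le_mul_of_nonneg_right hδγ₁ (mul_nonneg hθ.le (sub_nonneg.2 hS))
      linarith
    have h4 : γ₁ * (2 + θ * S) ≤ ρ * (2 + θ * S) :=
      mul_le_mul_of_nonneg_right (le_max_left _ _) (by nlinarith)
    nlinarith
  -- Induction peels off the first transition and applies the contraction to `z ↦ κ ^ m z A`. The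
  -- factor `1 / 2` turns the weight `2 + …` into the trivial bound `1` at `m = 0`.
  have step : ∀ (A : Set α), MeasurableSet A → ∀ (m : ℕ) (x y : α),
      |((κ ^ m) x).real A - ((κ ^ m) y).real A| ≤ ρ ^ m * (1 / 2) * (2 + θ * V x + θ * V y) := by
    intro A hA m
    have hmk := fun m => isMarkovKernel_pow κ m
    induction m with
    | zero =>
      intro x y
      have h1 : ∀ x, 0 ≤ ((κ ^ 0) x).real A := fun _ => measureReal_nonneg
      have h2 : ∀ x, ((κ ^ 0) x).real A ≤ 1 := fun _ => measureReal_le_one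
      have := mul_nonneg hθ.le (hV0 x)
      have := mul_nonneg hθ.le (hV0 y)
      rw [abs_le, pow_zero]
      constructor <;> linarith [h1 x, h1 y, h2 x, h2 y]
    | succ m ih =>
      intro x y
      have hrec : ∀ x, ((κ ^ (m + 1)) x).real A = ∫ z, ((κ ^ m) z).real A ∂(κ x) := by
        intro x
        have := Kernel.pow_add_apply_eq_lintegral κ 1 m x hA
        rw [pow_one, add_comm] at this
        rw [measureReal_def, this, integral_eq_lintegral_of_nonneg_ae
          (Filter.Eventually.of_forall fun _ => measureReal_nonneg)
          (Kernel.measurable_coe _ hA).ennreal_toReal.aestronglyMeasurable]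
        congr 1
        refine lintegral_congr fun z => ?_
        rw [ofReal_measureReal]
      rw [hrec x, hrec y]
      have := abs_integral_sub_le κ hVm hV0 hγ0 hb hθ.le drift hν rfl hθa
        ((le_max_left _ _).trans (le_max_right _ _)) ((le_max_right _ _).trans (le_max_right _ _))
        hρR (φ := fun z => ((κ ^ m) z).real A) (Kernel.measurable_coe _ hA).ennreal_toReal
        (B := 1) (fun z => by rw [abs_of_nonneg measureReal_nonneg]; exact measureReal_le_one)
        (K := ρ ^ m * (1 / 2)) (by positivity) (fun x y => (le_abs_self _).trans (ih x y)) x y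
      refine this.trans (le_of_eq ?_)
      ring
  have hVπi := integrable_of_lintegral_ofReal_le hVm hV0 ENNReal.toReal_nonneg
    (ENNReal.ofReal_toReal hVπ).ge
  refine ⟨ρ, hρ0, hρ1, fun x => 1 / 2 * (2 + θ * V x + θ * ∫ y, V y ∂π), fun x => ?_, ?_⟩
  · have := hV0 x
    have : 0 ≤ ∫ y, V y ∂π := integral_nonneg hV0
    positivity
  intro m x
  have : Nonempty {A : Set α // MeasurableSet A} := ⟨⟨∅, MeasurableSet.empty⟩⟩
  refine ciSup_le fun ⟨A, hA⟩ => ?_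
  have hmk := isMarkovKernel_pow κ m
  have hmeas : Measurable fun z => ((κ ^ m) z).real A :=
    (Kernel.measurable_coe _ hA).ennreal_toReal
  have hbd : Integrable (fun z => ((κ ^ m) z).real A) π :=
    Integrable.of_bound hmeas.aestronglyMeasurable 1 (Filter.Eventually.of_forall fun z => by
      rw [Real.norm_of_nonneg measureReal_nonneg]; exact measureReal_le_one)
  -- Invariance makes the distance to `π` an average over `z ∼ π` of the two-point bounds in `step`.
  have hπA : π.real A = ∫ z, ((κ ^ m) z).real A ∂π := by
    have h1 : π A = ∫⁻ z, (κ ^ m) z A ∂π := by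
      conv_lhs => rw [← (invariant_pow hinv m).def]
      rw [Measure.bind_apply hA (Kernel.aemeasurable _)]
    rw [measureReal_def, h1, integral_eq_lintegral_of_nonneg_ae
      (Filter.Eventually.of_forall fun _ => measureReal_nonneg) hmeas.aestronglyMeasurable]
    congr 1
    refine lintegral_congr fun z => ?_
    rw [ofReal_measureReal]
  have h2 : ((κ ^ m) x).real A - π.real A =
      ∫ z, (((κ ^ m) x).real A - ((κ ^ m) z).real A) ∂π := by
    rw [integral_sub (integrable_const _) hbd, hπA]
    simp
  have hi : Integrable (fun z => 2 + θ * V x + θ * V z) π :=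
    (integrable_const _).add (hVπi.1.const_mul θ)
  simp only
  rw [h2, ← Real.norm_eq_abs]
  refine (norm_integral_le_of_norm_le (hi.const_mul (ρ ^ m * (1 / 2)))
    (Filter.Eventually.of_forall fun z => step A hA m x z)).trans (le_of_eq ?_)
  rw [integral_const_mul, integral_add (integrable_const _) (hVπi.1.const_mul θ),
    integral_const_mul]
  simp
  ring

end Harris


/-! ### Gaussian integrals with a given precision matrix -/

section Gaussian

theorem lintegral_fin_prod {n : ℕ} (f : Fin n → ℝ → ℝ≥0∞) (hf : ∀ i, Measurable (f i)) :
    ∫⁻ x : Fin n → ℝ, ∏ i, f i (x i) = ∏ i, ∫⁻ t, f i t := by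
  induction n with
  | zero => simp [volume_pi]
  | succ n ih =>
    have hm : Measurable fun x : Fin n → ℝ => ∏ i, f (Fin.succ i) (x i) :=
      Finset.measurable_prod _ fun i _ => (hf _).comp (measurable_pi_apply i)
    rw [← (volume_preserving_piFinSuccAbove (fun _ : Fin (n + 1) => ℝ) 0).symm.lintegral_comp_emb
      (MeasurableEquiv.measurableEmbedding _)]
    simp_rw [MeasurableEquiv.piFinSuccAbove_symm_apply, Fin.insertNthEquiv,
      Fin.prod_univ_succ, Fin.insertNth_zero, Equiv.coe_fn_mk, Fin.cons_succ, Fin.cons_zero]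
    rw [← ih _ fun i => hf _]
    exact lintegral_prod_mul (hf 0).aemeasurable hm.aemeasurable

theorem lintegral_exp_neg_half_sq :
    ∫⁻ x : ℝ, ENNReal.ofReal (Real.exp (-(1 / 2) * x ^ 2)) = ENNReal.ofReal (√(2 * Real.pi)) := by
  rw [← ofReal_integral_eq_lintegral_ofReal (integrable_exp_neg_mul_sq (by norm_num))
    (Filter.Eventually.of_forall fun _ => (Real.exp_pos _).le), integral_gaussian]
  congr 2
  ring

open scoped MatrixOrder in
theorem exists_det_ne_zero_of_posDef {p : ℕ} {Q : Matrix (Fin p) (Fin p) ℝ} (hQ : Q.PosDef) :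
    ∃ L : Matrix (Fin p) (Fin p) ℝ, L.det ≠ 0 ∧ Q = Lᵀ * L := by
  obtain ⟨L, hL, rfl⟩ := CStarAlgebra.isStrictlyPositive_iff_eq_star_mul_self.mp
    hQ.isStrictlyPositive
  exact ⟨L, ((isUnit_iff_isUnit_det _).1 hL).ne_zero, by
    rw [star_eq_conjTranspose, conjTranspose_eq_transpose_of_trivial]⟩

theorem dotProduct_transpose_mul_mulVec {p n : ℕ} (L : Matrix (Fin n) (Fin p) ℝ)
    (x y : Fin p → ℝ) : x ⬝ᵥ ((Lᵀ * L) *ᵥ y) = (L *ᵥ x) ⬝ᵥ (L *ᵥ y) := by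
  rw [← mulVec_mulVec, dotProduct_mulVec, vecMul_transpose]

/-- Factor `Q = Lᵀ L` and substitute `L (β - a)`; the integral splits into one-dimensional
Gaussians. -/
theorem lintegral_exp_neg_half_quadForm {p : ℕ} {Q : Matrix (Fin p) (Fin p) ℝ} (hQ : Q.PosDef)
    (a : Fin p → ℝ) :
    ∫⁻ β : Fin p → ℝ, ENNReal.ofReal (Real.exp (-(1 / 2) * ((β - a) ⬝ᵥ (Q *ᵥ (β - a))))) =
      ENNReal.ofReal (√((2 * Real.pi) ^ p / Q.det)) := by
  obtain ⟨L, hL, rfl⟩ := exists_det_ne_zero_of_posDef hQ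
  rw [lintegral_sub_right_eq_self (μ := volume) (fun β : Fin p → ℝ =>
    ENNReal.ofReal (Real.exp (-(1 / 2) * (β ⬝ᵥ ((Lᵀ * L) *ᵥ β))))) a]
  simp_rw [dotProduct_transpose_mul_mulVec]
  have hm : Measurable fun x : Fin p → ℝ =>
      ENNReal.ofReal (Real.exp (-(1 / 2) * (x ⬝ᵥ x))) := by
    simp only [dotProduct]; fun_prop
  have h1 := lintegral_map (μ := volume) hm (LinearMap.continuous_on_pi (toLin' L)).measurable
  rw [Real.map_matrix_volume_pi_eq_smul_volume_pi hL, lintegral_smul_measure] at h1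
  simp only [toLin'_apply] at h1
  rw [← h1]
  have h2 : ∀ x : Fin p → ℝ, ENNReal.ofReal (Real.exp (-(1 / 2) * (x ⬝ᵥ x))) =
      ∏ i, ENNReal.ofReal (Real.exp (-(1 / 2) * (x i) ^ 2)) := by
    intro x
    rw [← ENNReal.ofReal_prod_of_nonneg fun i _ => (Real.exp_pos _).le, ← Real.exp_sum,
      dotProduct, Finset.mul_sum]
    simp only [sq]
  simp_rw [h2]
  rw [lintegral_fin_prod (fun _ t => ENNReal.ofReal (Real.exp (-(1 / 2) * t ^ 2)))
    (fun _ => by fun_prop)]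
  simp only [lintegral_exp_neg_half_sq, Finset.prod_const, Finset.card_univ, Fintype.card_fin]
  rw [← ENNReal.ofReal_pow (Real.sqrt_nonneg _), smul_eq_mul,
    ← ENNReal.ofReal_mul (abs_nonneg _)]
  congr 1
  rw [det_mul, det_transpose, Real.sqrt_div (by positivity), Real.sqrt_mul_self_eq_abs, abs_inv,
    div_eq_inv_mul]
  congr 1
  rw [eq_comm, Real.sqrt_eq_iff_mul_self_eq (by positivity) (by positivity), ← mul_pow,
    Real.mul_self_sqrt (by positivity)]

theorem measurable_normalPDF {p : ℕ} (a : Fin p → ℝ) (Q : Matrix (Fin p) (Fin p) ℝ) :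
    Measurable (normalPDF a Q) := by
  unfold normalPDF
  simp only [mulVec, dotProduct, Pi.sub_apply]
  fun_prop

theorem lintegral_normalPDF {p : ℕ} {Q : Matrix (Fin p) (Fin p) ℝ} (hQ : Q.PosDef)
    (a : Fin p → ℝ) : ∫⁻ β, normalPDF a Q β = 1 := by
  unfold normalPDF
  simp_rw [ENNReal.ofReal_mul (Real.sqrt_nonneg _)]
  rw [lintegral_const_mul' _ _ ENNReal.ofReal_ne_top, lintegral_exp_neg_half_quadForm hQ,
    ← ENNReal.ofReal_mul (Real.sqrt_nonneg _), ← Real.sqrt_mul (by have := hQ.det_pos; positivity)]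
  have := hQ.det_pos
  have h : Q.det / (2 * Real.pi) ^ p * ((2 * Real.pi) ^ p / Q.det) = 1 := by field_simp
  simp [h]

/-- The tilt halves the precision, so only a ratio of determinants remains. The value does not
depend on `Q`, which makes later moment bounds uniform in the latent variables. -/
theorem lintegral_exp_quarter_mul_normalPDF {p : ℕ} {Q : Matrix (Fin p) (Fin p) ℝ}
    (hQ : Q.PosDef) (a : Fin p → ℝ) :
    ∫⁻ β, ENNReal.ofReal (Real.exp (1 / 4 * ((β - a) ⬝ᵥ (Q *ᵥ (β - a))))) * normalPDF a Q β =
      ENNReal.ofReal (√(2 ^ p)) := by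
  have hQ' : ((1 / 2 : ℝ) • Q).PosDef := hQ.smul (by norm_num)
  have hd := hQ.det_pos
  have h1 : ∀ β : Fin p → ℝ,
      ENNReal.ofReal (Real.exp (1 / 4 * ((β - a) ⬝ᵥ (Q *ᵥ (β - a))))) * normalPDF a Q β =
      ENNReal.ofReal (√(Q.det / (2 * Real.pi) ^ p)) * ENNReal.ofReal (Real.exp (-(1 / 2) *
        ((β - a) ⬝ᵥ (((1 / 2 : ℝ) • Q) *ᵥ (β - a))))) := by
    intro β
    unfold normalPDF
    rw [← ENNReal.ofReal_mul (Real.exp_pos _).le, ← ENNReal.ofReal_mul (Real.sqrt_nonneg _),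
      mul_left_comm, ← Real.exp_add, smul_mulVec, dotProduct_smul, smul_eq_mul]
    congr 3
    ring
  simp_rw [h1]
  rw [lintegral_const_mul' _ _ ENNReal.ofReal_ne_top, lintegral_exp_neg_half_quadForm hQ',
    ← ENNReal.ofReal_mul (Real.sqrt_nonneg _), ← Real.sqrt_mul (by positivity), det_smul,
    Fintype.card_fin]
  congr 2
  field_simp
  rw [← mul_pow]
  norm_num

end Gaussian

/-! ### The norm induced by the prior precision -/

section WeightedNorm

variable {p : ℕ}

/-- The norm `√(xᵀ Ψ x)` associated with a positive definite matrix `Ψ`. -/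
noncomputable def wnorm (Ψ : Matrix (Fin p) (Fin p) ℝ) (x : Fin p → ℝ) : ℝ := √(x ⬝ᵥ (Ψ *ᵥ x))

variable {Ψ : Matrix (Fin p) (Fin p) ℝ}

theorem wnorm_nonneg (x : Fin p → ℝ) : 0 ≤ wnorm Ψ x := Real.sqrt_nonneg _

theorem measurable_wnorm (Ψ : Matrix (Fin p) (Fin p) ℝ) : Measurable (wnorm Ψ) := by
  unfold wnorm
  simp only [mulVec, dotProduct]
  fun_prop

theorem quadForm_nonneg (hΨ : Ψ.PosDef) (x : Fin p → ℝ) : 0 ≤ x ⬝ᵥ (Ψ *ᵥ x) := by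
  simpa using hΨ.posSemidef.dotProduct_mulVec_nonneg x

theorem wnorm_sq (hΨ : Ψ.PosDef) (x : Fin p → ℝ) : wnorm Ψ x ^ 2 = x ⬝ᵥ (Ψ *ᵥ x) :=
  Real.sq_sqrt (quadForm_nonneg hΨ x)

theorem dotProduct_mulVec_comm (hΨ : Ψ.PosDef) (x y : Fin p → ℝ) :
    x ⬝ᵥ (Ψ *ᵥ y) = y ⬝ᵥ (Ψ *ᵥ x) := by
  have h : Ψᵀ = Ψ := by simpa using hΨ.isHermitian.eq
  conv_lhs => rw [← h, mulVec_transpose, dotProduct_comm, ← dotProduct_mulVec]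

theorem dotProduct_mulVec_le (hΨ : Ψ.PosDef) (x y : Fin p → ℝ) :
    x ⬝ᵥ (Ψ *ᵥ y) ≤ wnorm Ψ x * wnorm Ψ y := by
  obtain ⟨L, hL, rfl⟩ := exists_det_ne_zero_of_posDef hΨ
  unfold wnorm
  rw [← Real.sqrt_mul (quadForm_nonneg hΨ x)]
  refine Real.le_sqrt_of_sq_le ?_
  simp only [dotProduct_transpose_mul_mulVec]
  have h := Finset.sum_mul_sq_le_sq_mul_sq Finset.univ (L *ᵥ x) (L *ᵥ y)
  simpa only [dotProduct, sq] using h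

theorem wnorm_neg (x : Fin p → ℝ) : wnorm Ψ (-x) = wnorm Ψ x := by
  simp [wnorm, mulVec_neg]

theorem wnorm_add_le (hΨ : Ψ.PosDef) (x y : Fin p → ℝ) :
    wnorm Ψ (x + y) ≤ wnorm Ψ x + wnorm Ψ y := by
  refine Real.sqrt_le_iff.2 ⟨add_nonneg (wnorm_nonneg x) (wnorm_nonneg y), ?_⟩
  rw [add_sq, wnorm_sq hΨ, wnorm_sq hΨ, mulVec_add, add_dotProduct, dotProduct_add, dotProduct_add,
    dotProduct_mulVec_comm hΨ y x]
  linarith [dotProduct_mulVec_le hΨ x y]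

/-- `(X β) i` is the `Ψ`-inner product of `β` with `Ψ⁻¹ x_i`; apply Cauchy–Schwarz and sum the norms
of these vectors to get one `K` for all rows. -/
theorem exists_abs_mulVec_le {n : ℕ} (hΨ : Ψ.PosDef) (X : Matrix (Fin n) (Fin p) ℝ) :
    ∃ K, 0 ≤ K ∧ ∀ β i, |(X *ᵥ β) i| ≤ K * wnorm Ψ β := by
  have h1 : ∀ β i, (X *ᵥ β) i ≤ (∑ j, wnorm Ψ (Ψ⁻¹ *ᵥ X j)) * wnorm Ψ β := by
    intro β i
    have hu : IsUnit Ψ.det := hΨ.det_pos.ne'.isUnit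
    have h2 : (X *ᵥ β) i = β ⬝ᵥ (Ψ *ᵥ (Ψ⁻¹ *ᵥ X i)) := by
      rw [mulVec_mulVec, mul_nonsing_inv _ hu, one_mulVec, dotProduct_comm]
      rfl
    rw [h2, dotProduct_mulVec_comm hΨ]
    refine (dotProduct_mulVec_le hΨ _ _).trans ?_
    refine mul_le_mul_of_nonneg_right ?_ (wnorm_nonneg _)
    exact Finset.single_le_sum (f := fun j => wnorm Ψ (Ψ⁻¹ *ᵥ X j))
      (fun j _ => wnorm_nonneg _) (Finset.mem_univ i)
  refine ⟨_, Finset.sum_nonneg fun j _ => wnorm_nonneg _, fun β i => abs_le.2 ⟨?_, h1 β i⟩⟩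
  have := h1 (-β) i
  rw [wnorm_neg, mulVec_neg, Pi.neg_apply] at this
  linarith

theorem lintegral_wnorm_normalPDF_le (hΨ : Ψ.PosDef) {Q : Matrix (Fin p) (Fin p) ℝ}
    (hQ : Q.PosDef) (hΨQ : ∀ x, x ⬝ᵥ (Ψ *ᵥ x) ≤ x ⬝ᵥ (Q *ᵥ x)) (a : Fin p → ℝ) :
    ∫⁻ β, ENNReal.ofReal (wnorm Ψ β) * normalPDF a Q β ≤
      ENNReal.ofReal (wnorm Ψ a + √(2 ^ p)) := by
  -- `t ≤ 1 + t² / 4 ≤ exp (t² / 4)`, with `t²` at most the `Q`-form.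
  have h1 : ∀ x : Fin p → ℝ, wnorm Ψ x ≤ Real.exp (1 / 4 * (x ⬝ᵥ (Q *ᵥ x))) := by
    intro x
    have h2 := Real.add_one_le_exp (1 / 4 * (x ⬝ᵥ (Q *ᵥ x)))
    have h3 := hΨQ x
    rw [← wnorm_sq hΨ] at h3
    nlinarith [sq_nonneg (wnorm Ψ x - 2)]
  calc ∫⁻ β, ENNReal.ofReal (wnorm Ψ β) * normalPDF a Q β
      ≤ ∫⁻ β, (ENNReal.ofReal (wnorm Ψ a) * normalPDF a Q β +
          ENNReal.ofReal (Real.exp (1 / 4 * ((β - a) ⬝ᵥ (Q *ᵥ (β - a))))) * normalPDF a Q β) := by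
        refine lintegral_mono fun β => ?_
        rw [← add_mul, ← ENNReal.ofReal_add (wnorm_nonneg _) (Real.exp_pos _).le]
        gcongr
        have := wnorm_add_le hΨ a (β - a)
        rw [add_sub_cancel] at this
        exact this.trans (by gcongr; exact h1 _)
    _ = ENNReal.ofReal (wnorm Ψ a + √(2 ^ p)) := by
        rw [lintegral_add_left ((measurable_normalPDF a Q).const_mul _),
          lintegral_const_mul' _ _ ENNReal.ofReal_ne_top, lintegral_normalPDF hQ,
          lintegral_exp_quarter_mul_normalPDF hQ, mul_one,
          ← ENNReal.ofReal_add (wnorm_nonneg _) (Real.sqrt_nonneg _)]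

end WeightedNorm

/-! ### Contraction of the conditional mean -/

section ConditionalMean

variable {n p : ℕ} (X : Matrix (Fin n) (Fin p) ℝ) (N : Fin n → ℝ)
    {Ψ : Matrix (Fin p) (Fin p) ℝ} (z : (Fin n → ℝ) × (Fin n → ℝ))

theorem dotProduct_condPrec_mulVec (Ψ : Matrix (Fin p) (Fin p) ℝ) (x y : Fin p → ℝ) :
    x ⬝ᵥ (condPrec X N Ψ z *ᵥ y) =
      x ⬝ᵥ (Ψ *ᵥ y) + ∑ i, weight N z i * ((X *ᵥ x) i * (X *ᵥ y) i) := by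
  rw [condPrec, add_mulVec, dotProduct_add, Matrix.mul_assoc, ← mulVec_mulVec,
    dotProduct_mulVec x Xᵀ, vecMul_transpose, ← mulVec_mulVec]
  congr 1
  refine Finset.sum_congr rfl fun i _ => ?_
  rw [mulVec_diagonal]
  ring

theorem posDef_condPrec (hΨ : Ψ.PosDef) (hz : ∀ i, 0 ≤ weight N z i) :
    (condPrec X N Ψ z).PosDef := by
  refine hΨ.add_posSemidef ?_
  have := (PosSemidef.diagonal (d := weight N z) hz).conjTranspose_mul_mul_same X
  rwa [conjTranspose_eq_transpose_of_trivial] at this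

theorem quadForm_le_condPrec (hz : ∀ i, 0 ≤ weight N z i) (x : Fin p → ℝ) :
    x ⬝ᵥ (Ψ *ᵥ x) ≤ x ⬝ᵥ (condPrec X N Ψ z *ᵥ x) := by
  rw [dotProduct_condPrec_mulVec]
  have : 0 ≤ ∑ i, weight N z i * ((X *ᵥ x) i * (X *ᵥ x) i) :=
    Finset.sum_nonneg fun i _ => mul_nonneg (hz i) (mul_self_nonneg _)
  linarith

variable {X N z}

/-- Pair the equation with `b`: its left side dominates the squared `Ψ`-norm of `b`, its right side
is linear in that norm, and one factor cancels. -/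
theorem wnorm_solution_le (hΨ : Ψ.PosDef) (hz : ∀ i, 0 ≤ weight N z i) {K : ℝ} (hK : 0 ≤ K)
    (hX : ∀ β i, |(X *ᵥ β) i| ≤ K * wnorm Ψ β) {b ν : Fin p → ℝ} {e : Fin n → ℝ}
    (hb : condPrec X N Ψ z *ᵥ b = Ψ *ᵥ ν + Xᵀ *ᵥ e) :
    wnorm Ψ b ≤ wnorm Ψ ν + K * ∑ i, |e i| := by
  have h1 := quadForm_le_condPrec X N z (Ψ := Ψ) hz b
  rw [hb, dotProduct_add, dotProduct_mulVec b Xᵀ, vecMul_transpose, ← wnorm_sq hΨ] at h1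
  have h2 : (X *ᵥ b) ⬝ᵥ e ≤ K * wnorm Ψ b * ∑ i, |e i| := by
    rw [Finset.mul_sum]
    refine Finset.sum_le_sum fun i _ => (le_abs_self _).trans ?_
    rw [abs_mul]
    exact mul_le_mul_of_nonneg_right (hX b i) (abs_nonneg _)
  have h3 := dotProduct_mulVec_le hΨ b ν
  rcases (wnorm_nonneg (Ψ := Ψ) b).eq_or_lt with h0 | h0
  · rw [← h0]
    exact add_nonneg (wnorm_nonneg ν)
      (mul_nonneg hK (Finset.sum_nonneg fun i _ => abs_nonneg _))
  · nlinarith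

/-- The equation reads `Ψ b = Xᵀ W X (β - b)`. Pairing with `b` and with `β - b`, Cauchy–Schwarz for
the form `Xᵀ W X` gives `‖b‖⁴ ≤ a ‖b‖² ⟨β - b, b⟩` in the `Ψ`-geometry, hence `(1 + a) ‖b‖ ≤ a ‖β‖`.
-/
theorem wnorm_solution_le_shrink (hΨ : Ψ.PosDef) (hz : ∀ i, 0 ≤ weight N z i) {K : ℝ}
    (hX : ∀ β i, |(X *ᵥ β) i| ≤ K * wnorm Ψ β) {b β : Fin p → ℝ}
    (hb : condPrec X N Ψ z *ᵥ b = Xᵀ *ᵥ (fun i => weight N z i * (X *ᵥ β) i)) :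
    (1 + K ^ 2 * ∑ i, weight N z i) * wnorm Ψ b ≤ (K ^ 2 * ∑ i, weight N z i) * wnorm Ψ β := by
  set a := K ^ 2 * ∑ i, weight N z i with ha
  have ha0 : 0 ≤ a := mul_nonneg (sq_nonneg _) (Finset.sum_nonneg fun i _ => hz i)
  have h1 : ∀ x, x ⬝ᵥ (Ψ *ᵥ b) = ∑ i, weight N z i * ((X *ᵥ x) i * (X *ᵥ (β - b)) i) := by
    intro x
    have h2 := dotProduct_condPrec_mulVec X N z Ψ x b
    rw [hb, dotProduct_mulVec x Xᵀ, vecMul_transpose] at h2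
    rw [eq_comm, ← eq_sub_iff_add_eq] at h2
    rw [h2, dotProduct, ← Finset.sum_sub_distrib]
    refine Finset.sum_congr rfl fun i _ => ?_
    rw [mulVec_sub, Pi.sub_apply]
    ring
  have hcs : (b ⬝ᵥ (Ψ *ᵥ b)) ^ 2 ≤ (a * wnorm Ψ b ^ 2) * ((β - b) ⬝ᵥ (Ψ *ᵥ b)) := by
    rw [h1 b, h1 (β - b)]
    have h3 : ∑ i, weight N z i * ((X *ᵥ b) i * (X *ᵥ b) i) ≤ a * wnorm Ψ b ^ 2 := by
      rw [ha, mul_right_comm, mul_comm, Finset.sum_mul]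
      refine Finset.sum_le_sum fun i _ => mul_le_mul_of_nonneg_left ?_ (hz i)
      rw [← mul_pow, ← sq]
      exact sq_le_sq' (by linarith [neg_abs_le ((X *ᵥ b) i), hX b i])
        ((le_abs_self _).trans (hX b i))
    refine le_trans ?_ (mul_le_mul_of_nonneg_right h3
      (Finset.sum_nonneg fun i _ => mul_nonneg (hz i) (mul_self_nonneg _)))
    refine Finset.sum_sq_le_sum_mul_sum_of_sq_le_mul _
      (fun i _ => mul_nonneg (hz i) (mul_self_nonneg _))
      (fun i _ => mul_nonneg (hz i) (mul_self_nonneg _)) fun i _ => le_of_eq ?_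
    ring
  have h4 : (β - b) ⬝ᵥ (Ψ *ᵥ b) = β ⬝ᵥ (Ψ *ᵥ b) - wnorm Ψ b ^ 2 := by
    rw [sub_dotProduct, wnorm_sq hΨ]
  have h5 := dotProduct_mulVec_le hΨ β b
  rw [← wnorm_sq hΨ, h4] at hcs
  rcases (wnorm_nonneg (Ψ := Ψ) b).eq_or_lt with h0 | h0
  · rw [← h0, mul_zero]
    exact mul_nonneg ha0 (wnorm_nonneg _)
  · have h6 : wnorm Ψ b ^ 2 ≤ a * (wnorm Ψ β * wnorm Ψ b - wnorm Ψ b ^ 2) := by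
      have h7 : wnorm Ψ b ^ 2 * wnorm Ψ b ^ 2 ≤
          wnorm Ψ b ^ 2 * (a * (wnorm Ψ β * wnorm Ψ b - wnorm Ψ b ^ 2)) := by
        have := mul_le_mul_of_nonneg_left h5 (mul_nonneg ha0 (sq_nonneg (wnorm Ψ b)))
        nlinarith
      exact le_of_mul_le_mul_left h7 (by positivity)
    refine le_of_mul_le_mul_right ?_ h0
    nlinarith

/-- The conditional mean contracts, up to the errors `u i - w i * (X β) i`. The coefficient of
`wnorm Ψ β` is the tangent line at `A` of the concave function `a / (1 + a)`. -/
theorem wnorm_condMean_le (hΨ : Ψ.PosDef) (hN : ∀ i, 0 < N i) (hz : ∀ i, 0 ≤ weight N z i) {K : ℝ}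
    (hK : 0 ≤ K) (hX : ∀ β i, |(X *ᵥ β) i| ≤ K * wnorm Ψ β) (μ β : Fin p → ℝ) {A : ℝ}
    (hA : 0 ≤ A) :
    wnorm Ψ (condMean X N μ Ψ z) ≤
      (A ^ 2 + K ^ 2 * ∑ i, weight N z i) / (1 + A) ^ 2 * wnorm Ψ β +
      (wnorm Ψ μ + K * ∑ i, (|z.1 i - weight N z i * (X *ᵥ β) i| + N i / 2)) := by
  have hu : IsUnit (condPrec X N Ψ z).det := (posDef_condPrec X N z hΨ hz).det_pos.ne'.isUnit
  have hsolve : ∀ r, condPrec X N Ψ z *ᵥ ((condPrec X N Ψ z)⁻¹ *ᵥ r) = r := fun r => by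
    rw [mulVec_mulVec, mul_nonsing_inv _ hu, one_mulVec]
  set r₁ := Xᵀ *ᵥ (fun i => weight N z i * (X *ᵥ β) i) with hr₁
  set r₂ := Ψ *ᵥ μ + Xᵀ *ᵥ (fun i => z.1 i - N i / 2 - weight N z i * (X *ᵥ β) i) with hr₂
  have hsplit : condMean X N μ Ψ z = (condPrec X N Ψ z)⁻¹ *ᵥ r₁ + (condPrec X N Ψ z)⁻¹ *ᵥ r₂ := by
    rw [condMean, ← mulVec_add, hr₁, hr₂, add_left_comm, ← mulVec_add]
    congr 3
    ext i
    simp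
  rw [hsplit]
  refine (wnorm_add_le hΨ _ _).trans (add_le_add ?_ ?_)
  · have h1 := wnorm_solution_le_shrink hΨ hz hX (hsolve r₁)
    set a := K ^ 2 * ∑ i, weight N z i with ha
    have ha0 : 0 ≤ a := mul_nonneg (sq_nonneg _) (Finset.sum_nonneg fun i _ => hz i)
    -- The difference is a nonnegative multiple of `(A - a)²`. The bound is affine in the weights,
    -- so only their means are needed afterwards.
    have h2 : a / (1 + a) ≤ (A ^ 2 + a) / (1 + A) ^ 2 := by
      rw [div_le_div_iff₀ (by positivity) (by positivity)]
      nlinarith [sq_nonneg (A - a)]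
    refine le_trans ?_ (mul_le_mul_of_nonneg_right h2 (wnorm_nonneg β))
    rw [div_mul_eq_mul_div, le_div_iff₀ (by positivity)]
    linarith
  · refine (wnorm_solution_le hΨ hz hK hX (hsolve r₂)).trans ?_
    gcongr with i
    rw [sub_right_comm]
    refine (abs_sub _ _).trans ?_
    rw [abs_of_pos (half_pos (hN i))]

end ConditionalMean


/-! ### Inverse Gaussian moments by a change of variables -/

section InverseGaussian

variable {a : ℝ}

/-- `v ↦ a √v - 1 / √v` is an increasing bijection from `(0, ∞)` onto `ℝ`. -/
theorem lintegral_comp_sqrt_sub_inv_sqrt (ha : 0 < a) (g : ℝ → ℝ≥0∞) :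
    ∫⁻ t, g t = ∫⁻ v in Set.Ioi 0,
      ENNReal.ofReal (1 / 2 * (a / √v + 1 / (v * √v))) * g (a * √v - 1 / √v) := by
  have hpos : ∀ v ∈ Set.Ioi (0 : ℝ), 0 < 1 / 2 * (a / √v + 1 / (v * √v)) := by
    intro v hv
    have hv : 0 < v := hv
    have := Real.sqrt_pos.2 hv
    positivity
  have hderiv : ∀ v ∈ Set.Ioi (0 : ℝ), HasDerivAt (fun v => a * √v - 1 / √v)
      (1 / 2 * (a / √v + 1 / (v * √v))) v := by
    intro v hv
    have hv : 0 < v := hv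
    have hs := Real.sqrt_pos.2 hv
    have h1 := Real.hasDerivAt_sqrt hv.ne'
    have h2 := (h1.const_mul a).sub (h1.inv hs.ne')
    simp only [one_div] at h2 ⊢
    convert! h2 using 1
    rw [Real.sq_sqrt hv.le]
    field_simp
    ring
  have hmono : StrictMonoOn (fun v => a * √v - 1 / √v) (Set.Ioi 0) := by
    intro v hv w hw hvw
    have hv : 0 < v := hv
    have hs := Real.sqrt_pos.2 hv
    have h1 := Real.sqrt_lt_sqrt hv.le hvw
    have h2 := one_div_lt_one_div_of_lt hs h1
    have h3 := mul_lt_mul_of_pos_left h1 ha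
    simp only
    linarith
  have himage : (fun v => a * √v - 1 / √v) '' Set.Ioi 0 = Set.univ := by
    refine Set.eq_univ_of_forall fun t => ?_
    have hq : |t| < √(t ^ 2 + 4 * a) := by
      rw [← Real.sqrt_sq_eq_abs]
      exact Real.sqrt_lt_sqrt (sq_nonneg t) (by linarith)
    have hx : 0 < (t + √(t ^ 2 + 4 * a)) / (2 * a) := by
      have := neg_abs_le t
      exact div_pos (by linarith) (by linarith)
    -- The positive root `x` of `a x² - t x - 1 = 0`, squared.
    refine ⟨((t + √(t ^ 2 + 4 * a)) / (2 * a)) ^ 2, by simpa using by positivity, ?_⟩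
    simp only
    rw [Real.sqrt_sq hx.le]
    have hsq : √(t ^ 2 + 4 * a) ^ 2 = t ^ 2 + 4 * a := Real.sq_sqrt (by positivity)
    set q := √(t ^ 2 + 4 * a) with hqdef
    have hne : t + q ≠ 0 := by
      intro h; rw [h] at hx; simp at hx
    have ha' := ha.ne'
    field_simp
    linear_combination hsq
  rw [← setLIntegral_univ, ← himage, lintegral_image_eq_lintegral_abs_deriv_mul measurableSet_Ioi
    (fun v hv => (hderiv v hv).hasDerivWithinAt) hmono.injOn]
  refine setLIntegral_congr_fun measurableSet_Ioi fun v hv => ?_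
  rw [abs_of_pos (hpos v hv)]

theorem lintegral_Ioi_comp_inv (ha : 0 < a) (h : ℝ → ℝ≥0∞) :
    ∫⁻ v in Set.Ioi 0, h v =
      ∫⁻ v in Set.Ioi 0, ENNReal.ofReal (1 / (a ^ 2 * v ^ 2)) * h (1 / (a ^ 2 * v)) := by
  have himage : (fun v => 1 / (a ^ 2 * v)) '' Set.Ioi 0 = Set.Ioi 0 := by
    ext t
    constructor
    · rintro ⟨v, hv, rfl⟩
      have hv : 0 < v := hv
      exact Set.mem_Ioi.2 (by positivity)
    · intro ht
      have ht : 0 < t := ht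
      exact ⟨1 / (a ^ 2 * t), Set.mem_Ioi.2 (by positivity), by simp only; field_simp⟩
  have hinj : Set.InjOn (fun v => 1 / (a ^ 2 * v)) (Set.Ioi 0) := by
    intro v hv w hw hvw
    have hv : 0 < v := hv
    have hw : 0 < w := hw
    simp only at hvw
    field_simp at hvw
    exact hvw.symm
  have hderiv : ∀ v ∈ Set.Ioi (0 : ℝ),
      HasDerivAt (fun v => 1 / (a ^ 2 * v)) (-(1 / (a ^ 2 * v ^ 2))) v := by
    intro v hv
    have hv : 0 < v := hv
    have h2 := ((hasDerivAt_id v).const_mul (a ^ 2)).inv (by simp only [id]; positivity)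
    simp only [one_div]
    convert! h2 using 1
    simp only [id]
    field_simp
  conv_lhs => rw [← himage]
  rw [lintegral_image_eq_lintegral_abs_deriv_mul measurableSet_Ioi
    (fun v hv => (hderiv v hv).hasDerivWithinAt) hinj]
  refine setLIntegral_congr_fun measurableSet_Ioi fun v hv => ?_
  rw [abs_neg, abs_of_nonneg (by positivity)]

/-- The substitution `v ↦ 1 / (a² v)` reverses the sign of `a √v - 1 / √v` and exchanges the two
terms of the Jacobian, so for even `g` each term carries half. The second term corresponds to the
inverse Gaussian density, the first to `v` times it. -/
theorem lintegral_even_comp (ha : 0 < a) {g : ℝ → ℝ≥0∞} (hg : Measurable g)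
    (heven : ∀ t, g (-t) = g t) :
    ∫⁻ v in Set.Ioi 0, ENNReal.ofReal (a / √v) * g (a * √v - 1 / √v) = ∫⁻ t, g t ∧
    ∫⁻ v in Set.Ioi 0, ENNReal.ofReal (1 / (v * √v)) * g (a * √v - 1 / √v) = ∫⁻ t, g t := by
  have h1 : ∫⁻ v in Set.Ioi 0, ENNReal.ofReal (a / √v) * g (a * √v - 1 / √v) =
      ∫⁻ v in Set.Ioi 0, ENNReal.ofReal (1 / (v * √v)) * g (a * √v - 1 / √v) := by
    rw [lintegral_Ioi_comp_inv ha]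
    refine setLIntegral_congr_fun measurableSet_Ioi fun v hv => ?_
    have hv : 0 < v := hv
    have hs := Real.sqrt_pos.2 hv
    have hsq : √(1 / (a ^ 2 * v)) = 1 / (a * √v) := by
      rw [Real.sqrt_div zero_le_one, Real.sqrt_one, Real.sqrt_mul (sq_nonneg a),
        Real.sqrt_sq ha.le]
    rw [hsq, ← mul_assoc, ← ENNReal.ofReal_mul (by positivity), ← heven]
    have hv2 : v = √v ^ 2 := (Real.sq_sqrt hv.le).symm
    congr 2
    · have : 1 / (a ^ 2 * v ^ 2) * (a / (1 / (a * √v))) = √v / v ^ 2 := by field_simp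
      rw [this, div_eq_div_iff (by positivity) (by positivity), one_mul]
      calc √v * (v * √v) = √v ^ 2 * v := by ring
        _ = v ^ 2 := by rw [← hv2, sq]
    · field_simp
      ring
  have h2 := lintegral_comp_sqrt_sub_inv_sqrt ha g
  have h3 : ∀ v : ℝ, v ∈ Set.Ioi (0 : ℝ) →
      ENNReal.ofReal (1 / 2 * (a / √v + 1 / (v * √v))) * g (a * √v - 1 / √v) =
      ENNReal.ofReal (1 / 2) * (ENNReal.ofReal (a / √v) * g (a * √v - 1 / √v)) +
      ENNReal.ofReal (1 / 2) * (ENNReal.ofReal (1 / (v * √v)) * g (a * √v - 1 / √v)) := by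
    intro v hv
    have hv : 0 < v := hv
    rw [ENNReal.ofReal_mul (by norm_num), ENNReal.ofReal_add (by positivity) (by positivity)]
    ring
  rw [setLIntegral_congr_fun measurableSet_Ioi h3, lintegral_add_left (by fun_prop),
    lintegral_const_mul' _ _ ENNReal.ofReal_ne_top,
    lintegral_const_mul' _ _ ENNReal.ofReal_ne_top, h1, ← add_mul,
    ← ENNReal.ofReal_add (by norm_num) (by norm_num)] at h2
  norm_num at h2
  rw [h1, h2]
  simp

/-- The exponent is the complete square `-(a √v - 1 / √v)² / 2`. -/
theorem invGaussPDF_of_pos (a : ℝ) {v : ℝ} (hv : 0 < v) :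
    invGaussPDF (1 / a) 1 v = ENNReal.ofReal (1 / (v * √v)) *
      ENNReal.ofReal ((√(2 * Real.pi))⁻¹ * Real.exp (-(1 / 2) * (a * √v - 1 / √v) ^ 2)) := by
  have hs := Real.sqrt_pos.2 hv
  have h1 : v ^ (3 / 2 : ℝ) = v * √v := by
    rw [Real.sqrt_eq_rpow, ← Real.rpow_one_add' hv.le (by norm_num)]
    norm_num
  have h2 : (a * √v - 1 / √v) ^ 2 = a ^ 2 * v - 2 * a + 1 / v := by
    have hv2 : √v ^ 2 = v := Real.sq_sqrt hv.le
    rw [sub_sq, mul_pow, div_pow, hv2]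
    field_simp
  rw [invGaussPDF, if_pos hv, ← ENNReal.ofReal_mul (by positivity), h1, h2]
  congr 1
  have h3 : Real.exp (1 / (1 / a)) * Real.exp (-(1 / 2) * (1 / (1 / a) ^ 2 * v + 1 / v)) =
      Real.exp (-(1 / 2) * (a ^ 2 * v - 2 * a + 1 / v)) := by
    rw [← Real.exp_add]
    congr 1
    field_simp
    ring
  rw [← h3, Real.sqrt_div zero_le_one, Real.sqrt_one]
  ring

theorem invGaussPDF_of_nonpos {m s v : ℝ} (hv : v ≤ 0) : invGaussPDF m s v = 0 := by
  rw [invGaussPDF, if_neg hv.not_gt, ENNReal.ofReal_zero]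

theorem lintegral_mul_invGaussPDF (m s : ℝ) (h : ℝ → ℝ≥0∞) :
    ∫⁻ v, h v * invGaussPDF m s v = ∫⁻ v in Set.Ioi 0, h v * invGaussPDF m s v := by
  rw [← lintegral_indicator measurableSet_Ioi]
  refine lintegral_congr fun v => ?_
  by_cases hv : 0 < v
  · rw [Set.indicator_of_mem (Set.mem_Ioi.2 hv)]
  · rw [Set.indicator_of_notMem (by simpa using hv), invGaussPDF_of_nonpos (not_lt.1 hv), mul_zero]

theorem lintegral_gauss :
    ∫⁻ t : ℝ, ENNReal.ofReal ((√(2 * Real.pi))⁻¹ * Real.exp (-(1 / 2) * t ^ 2)) = 1 := by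
  simp_rw [ENNReal.ofReal_mul (inv_nonneg.2 (Real.sqrt_nonneg (2 * Real.pi)))]
  rw [lintegral_const_mul' _ _ ENNReal.ofReal_ne_top, lintegral_exp_neg_half_sq,
    ← ENNReal.ofReal_mul (by positivity), inv_mul_cancel₀ (by positivity), ENNReal.ofReal_one]

/-- Any finite constant suffices: `t² ≤ 4 exp (t² / 4)` gives `4 √2 ≤ 6`. -/
theorem lintegral_sq_mul_gauss_le :
    ∫⁻ t : ℝ, ENNReal.ofReal (t ^ 2) *
      ENNReal.ofReal ((√(2 * Real.pi))⁻¹ * Real.exp (-(1 / 2) * t ^ 2)) ≤ ENNReal.ofReal 6 := by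
  have h1 : ∀ t : ℝ, ENNReal.ofReal (t ^ 2) *
      ENNReal.ofReal ((√(2 * Real.pi))⁻¹ * Real.exp (-(1 / 2) * t ^ 2)) ≤
      ENNReal.ofReal ((√(2 * Real.pi))⁻¹ * 4 * Real.exp (-(1 / 4) * t ^ 2)) := by
    intro t
    rw [← ENNReal.ofReal_mul (sq_nonneg t)]
    refine ENNReal.ofReal_le_ofReal ?_
    have h2 : t ^ 2 ≤ 4 * Real.exp (1 / 4 * t ^ 2) := by
      linarith [Real.add_one_le_exp (1 / 4 * t ^ 2)]
    calc t ^ 2 * ((√(2 * Real.pi))⁻¹ * Real.exp (-(1 / 2) * t ^ 2))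
        ≤ 4 * Real.exp (1 / 4 * t ^ 2) *
          ((√(2 * Real.pi))⁻¹ * Real.exp (-(1 / 2) * t ^ 2)) := by gcongr
      _ = (√(2 * Real.pi))⁻¹ * 4 *
          (Real.exp (1 / 4 * t ^ 2) * Real.exp (-(1 / 2) * t ^ 2)) := by ring
      _ = _ := by rw [← Real.exp_add]; congr 2; ring
  refine (lintegral_mono h1).trans ?_
  rw [← ofReal_integral_eq_lintegral_ofReal
    ((integrable_exp_neg_mul_sq (by norm_num)).const_mul _)
    (Filter.Eventually.of_forall fun _ => by positivity), integral_const_mul, integral_gaussian]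
  refine ENNReal.ofReal_le_ofReal ?_
  have h3 : √(Real.pi / (1 / 4)) = √2 * √(2 * Real.pi) := by
    rw [← Real.sqrt_mul (by norm_num)]
    congr 1
    ring
  rw [h3]
  have h4 : √2 ≤ 3 / 2 := Real.sqrt_le_iff.2 ⟨by norm_num, by norm_num⟩
  have h5 : 0 < √(2 * Real.pi) := by positivity
  field_simp
  linarith

theorem lintegral_even_mul_invGaussPDF (ha : 0 < a) {g : ℝ → ℝ≥0∞} (hg : Measurable g)
    (heven : ∀ t, g (-t) = g t) :
    ∫⁻ v, g (a * √v - 1 / √v) * invGaussPDF (1 / a) 1 v =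
      ∫⁻ t, g t * ENNReal.ofReal ((√(2 * Real.pi))⁻¹ * Real.exp (-(1 / 2) * t ^ 2)) := by
  rw [lintegral_mul_invGaussPDF, ← (lintegral_even_comp ha
    (g := fun t => g t * ENNReal.ofReal ((√(2 * Real.pi))⁻¹ * Real.exp (-(1 / 2) * t ^ 2)))
    (by fun_prop) (by intro t; simp only [heven, neg_sq])).2]
  refine setLIntegral_congr_fun measurableSet_Ioi fun v hv => ?_
  rw [invGaussPDF_of_pos a hv]
  ring

theorem lintegral_invGaussPDF (ha : 0 < a) : ∫⁻ v, invGaussPDF (1 / a) 1 v = 1 := by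
  have h := lintegral_even_mul_invGaussPDF ha (g := fun _ => 1) measurable_const (fun _ => rfl)
  simp only [one_mul] at h
  rw [h, lintegral_gauss]

theorem lintegral_sq_mul_invGaussPDF_le (ha : 0 < a) :
    ∫⁻ v, ENNReal.ofReal ((a * √v - 1 / √v) ^ 2) * invGaussPDF (1 / a) 1 v ≤
      ENNReal.ofReal 6 := by
  rw [lintegral_even_mul_invGaussPDF ha (g := fun t => ENNReal.ofReal (t ^ 2)) (by fun_prop)
    (fun t => by rw [neg_sq])]
  exact lintegral_sq_mul_gauss_le

theorem lintegral_ofReal_mul_invGaussPDF (ha : 0 < a) :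
    ∫⁻ v, ENNReal.ofReal v * invGaussPDF (1 / a) 1 v = ENNReal.ofReal (1 / a) := by
  have h := (lintegral_even_comp ha
    (g := fun t => ENNReal.ofReal ((√(2 * Real.pi))⁻¹ * Real.exp (-(1 / 2) * t ^ 2)))
    (by fun_prop) (by intro t; simp only [neg_sq])).1
  rw [lintegral_gauss] at h
  rw [lintegral_mul_invGaussPDF, ← mul_one (ENNReal.ofReal (1 / a)), ← h,
    ← lintegral_const_mul' _ _ ENNReal.ofReal_ne_top]
  refine setLIntegral_congr_fun measurableSet_Ioi fun v hv => ?_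
  have hv : 0 < v := hv
  have hs := Real.sqrt_pos.2 hv
  rw [invGaussPDF_of_pos a hv, ← mul_assoc, ← mul_assoc, ← ENNReal.ofReal_mul hv.le,
    ← ENNReal.ofReal_mul (p := 1 / a) (by positivity)]
  congr 2
  field_simp

end InverseGaussian

/-! ### Gamma moments -/

section GammaMoments

/-- Size biasing: `u` times the density of shape `a` is `a / r` times the density of shape `a + 1`.
-/
theorem lintegral_affine_mul_gammaPDF {a r k₀ k₁ : ℝ} (ha : 0 < a) (hr : 0 < r) (hk₀ : 0 ≤ k₀)
    (hk₁ : 0 ≤ k₁) :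
    ∫⁻ u, ENNReal.ofReal (k₀ + k₁ * u) * gammaPDF a r u = ENNReal.ofReal (k₀ + k₁ * (a / r)) := by
  have hm : Measurable (gammaPDF a r) := (measurable_gammaPDFReal a r).ennreal_ofReal
  have h1 : ∀ u, ENNReal.ofReal (k₀ + k₁ * u) * gammaPDF a r u =
      ENNReal.ofReal k₀ * gammaPDF a r u +
        ENNReal.ofReal (k₁ * (a / r)) * gammaPDF (a + 1) r u := by
    intro u
    rcases lt_trichotomy u 0 with hu | rfl | hu
    · simp [gammaPDF_of_neg hu]
    · rw [gammaPDF_of_nonneg (a := a + 1) le_rfl, add_sub_cancel_right, Real.zero_rpow ha.ne']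
      simp
    · rw [ENNReal.ofReal_add hk₀ (by positivity), add_mul]
      congr 1
      rw [gammaPDF_of_nonneg hu.le, gammaPDF_of_nonneg hu.le, ← ENNReal.ofReal_mul (by positivity),
        ← ENNReal.ofReal_mul (by positivity), add_sub_cancel_right, Real.Gamma_add_one ha.ne',
        Real.rpow_add_one hr.ne', Real.rpow_sub_one hu.ne']
      have := Real.Gamma_pos_of_pos ha
      congr 1
      field_simp
  simp_rw [h1]
  rw [lintegral_add_left (hm.const_mul _), lintegral_const_mul' _ _ ENNReal.ofReal_ne_top,
    lintegral_const_mul' _ _ ENNReal.ofReal_ne_top, lintegral_gammaPDF_eq_one ha hr,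
    lintegral_gammaPDF_eq_one (by linarith) hr, mul_one, mul_one,
    ENNReal.ofReal_add hk₀ (by positivity)]

end GammaMoments

/-! ### One pair of latent variables -/

section Site

/-- The conditional density of a single pair `(u, v)` of latent variables, given the linear
predictor `ξ`. -/
noncomputable def sitePDF (N : ℝ) (y : ℕ) (ξ u v : ℝ) : ℝ≥0∞ :=
  gammaPDF y (-ξ + √(ξ ^ 2 + 4)) u * invGaussPDF (1 / ((N / 2 + u) * √(ξ ^ 2 + 4))) 1 v

variable {N : ℝ} {y : ℕ} {ξ : ℝ}

theorem abs_lt_sqrt_sq_add_four (ξ : ℝ) : |ξ| < √(ξ ^ 2 + 4) := by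
  rw [← Real.sqrt_sq_eq_abs]
  exact Real.sqrt_lt_sqrt (sq_nonneg ξ) (by linarith)

theorem two_le_sqrt_sq_add_four (ξ : ℝ) : 2 ≤ √(ξ ^ 2 + 4) :=
  Real.le_sqrt_of_sq_le (by nlinarith [sq_nonneg ξ])

theorem rate_pos (ξ : ℝ) : 0 < -ξ + √(ξ ^ 2 + 4) := by
  linarith [abs_lt_sqrt_sq_add_four ξ, le_abs_self ξ]

theorem measurable_sitePDF (N : ℝ) (y : ℕ) (ξ : ℝ) :
    Measurable (Function.uncurry (sitePDF N y ξ)) := by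
  unfold sitePDF Function.uncurry
  have h1 : Measurable fun q : ℝ × ℝ => gammaPDF y (-ξ + √(ξ ^ 2 + 4)) q.1 :=
    (measurable_gammaPDF₂ y).comp (f := fun q : ℝ × ℝ => (-ξ + √(ξ ^ 2 + 4), q.1)) (by fun_prop)
  have h2 : Measurable fun q : ℝ × ℝ =>
      invGaussPDF (1 / ((N / 2 + q.1) * √(ξ ^ 2 + 4))) 1 q.2 :=
    (measurable_invGaussPDF₂ 1).comp (f := fun q : ℝ × ℝ =>
      (1 / ((N / 2 + q.1) * √(ξ ^ 2 + 4)), q.2)) (by fun_prop)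
  exact h1.mul h2

theorem sitePDF_of_neg {u v : ℝ} (hu : u < 0) : sitePDF N y ξ u v = 0 := by
  rw [sitePDF, gammaPDF_of_neg hu, zero_mul]

theorem sitePDF_of_nonpos {u v : ℝ} (hv : v ≤ 0) : sitePDF N y ξ u v = 0 := by
  rw [sitePDF, invGaussPDF_of_nonpos hv, mul_zero]

/-- A bound on the conditional expectation given `u` that is affine in `u` integrates. -/
theorem lintegral_sitePDF_le (hy : 1 ≤ y) {h : ℝ → ℝ → ℝ≥0∞} {k₀ k₁ k : ℝ} (hk₀ : 0 ≤ k₀)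
    (hk₁ : 0 ≤ k₁) (hk : k₀ + k₁ * (y / (-ξ + √(ξ ^ 2 + 4))) ≤ k)
    (hh : ∀ u, 0 ≤ u → ∫⁻ v, h u v * invGaussPDF (1 / ((N / 2 + u) * √(ξ ^ 2 + 4))) 1 v ≤
      ENNReal.ofReal (k₀ + k₁ * u)) :
    ∫⁻ u, ∫⁻ v, h u v * sitePDF N y ξ u v ≤ ENNReal.ofReal k := by
  have hy' : (0 : ℝ) < y := by exact_mod_cast hy
  refine le_trans (lintegral_mono fun u => ?_)
    ((lintegral_affine_mul_gammaPDF hy' (rate_pos ξ) hk₀ hk₁).le.trans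
      (ENNReal.ofReal_le_ofReal hk))
  rcases lt_or_ge u 0 with hu | hu
  · simp [sitePDF_of_neg hu]
  · unfold sitePDF
    rw [lintegral_congr fun v => mul_left_comm _ _ _, lintegral_const_mul' (gammaPDF _ _ _) _
      ENNReal.ofReal_ne_top, mul_comm]
    gcongr
    exact hh u hu

theorem lintegral_sitePDF (hN : 0 < N) (hy : 1 ≤ y) : ∫⁻ u, ∫⁻ v, sitePDF N y ξ u v = 1 := by
  have hy' : (0 : ℝ) < y := by exact_mod_cast hy
  rw [← lintegral_gammaPDF_eq_one hy' (rate_pos ξ)]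
  refine lintegral_congr fun u => ?_
  rcases lt_or_ge u 0 with hu | hu
  · simp [sitePDF_of_neg hu, gammaPDF_of_neg hu]
  · unfold sitePDF
    rw [lintegral_const_mul' (gammaPDF _ _ _) _ ENNReal.ofReal_ne_top, lintegral_invGaussPDF,
      mul_one]
    have := two_le_sqrt_sq_add_four ξ
    positivity

/-- With `s = √(ξ² + 4)`, `s (s - ξ) ≥ (s² - ξ²) / 2 = 2`. -/
theorem mean_div_sqrt_le (y : ℕ) (ξ : ℝ) :
    1 / √(ξ ^ 2 + 4) * (y / (-ξ + √(ξ ^ 2 + 4))) ≤ y / 2 := by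
  have h1 := rate_pos ξ
  have h2 := two_le_sqrt_sq_add_four ξ
  have h3 : √(ξ ^ 2 + 4) ^ 2 = ξ ^ 2 + 4 := Real.sq_sqrt (by positivity)
  have hy : (0 : ℝ) ≤ y := Nat.cast_nonneg y
  rw [one_div_mul_eq_div, div_div]
  refine div_le_div_of_nonneg_left hy two_pos ?_
  nlinarith [sq_nonneg (√(ξ ^ 2 + 4) - ξ)]

/-- Given `u`, the weight has mean `(N / 2 + u) / √(ξ² + 4)`, which is affine in `u`. -/
theorem lintegral_weight_mul_sitePDF_le (hN : 0 < N) (hy : 1 ≤ y) :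
    ∫⁻ u, ∫⁻ v, ENNReal.ofReal (v * (N / 2 + u) ^ 2) * sitePDF N y ξ u v ≤
      ENNReal.ofReal (N / 4 + y / 2) := by
  have hs := two_le_sqrt_sq_add_four ξ
  refine lintegral_sitePDF_le hy (k₀ := N / 2 / √(ξ ^ 2 + 4)) (k₁ := 1 / √(ξ ^ 2 + 4))
    (by positivity) (by positivity) ?_ fun u hu => ?_
  · refine add_le_add ?_ (mean_div_sqrt_le y ξ)
    rw [div_le_iff₀ (by positivity)]
    nlinarith
  · have hc : 0 < N / 2 + u := by positivity
    have hcs : 0 < (N / 2 + u) * √(ξ ^ 2 + 4) := by positivity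
    simp_rw [mul_comm _ ((N / 2 + u) ^ 2), ENNReal.ofReal_mul (sq_nonneg (N / 2 + u)), mul_assoc]
    rw [lintegral_const_mul' _ _ ENNReal.ofReal_ne_top, lintegral_ofReal_mul_invGaussPDF hcs,
      ← ENNReal.ofReal_mul (sq_nonneg _)]
    refine ENNReal.ofReal_le_ofReal (le_of_eq ?_)
    field_simp

/-- Insert the conditional mean `c ξ / s` of `w ξ`. The part without `v` is `u (s - ξ) / s` up to `N
/ 2`; the fluctuation factors through `t = c s √v - 1 / √v`, whose second moment is bounded, and is
split by `2 |x t| ≤ x² + t²`. -/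
theorem abs_sub_weight_mul_le (hN : 0 < N) {u v : ℝ} (hu : 0 ≤ u) (hv : 0 < v) (ξ : ℝ) :
    |u - v * (N / 2 + u) ^ 2 * ξ| ≤
      (N / 2 + (-ξ + √(ξ ^ 2 + 4)) / √(ξ ^ 2 + 4) * u) + 1 / 2 * (v * (N / 2 + u) ^ 2) +
        1 / 2 * ((N / 2 + u) * √(ξ ^ 2 + 4) * √v - 1 / √v) ^ 2 := by
  set s := √(ξ ^ 2 + 4) with hs
  have hs2 : 2 ≤ s := two_le_sqrt_sq_add_four ξ
  have hξ : |ξ| < s := abs_lt_sqrt_sq_add_four ξ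
  set c := N / 2 + u with hc
  have hc0 : 0 < c := by positivity
  set q := √v with hq
  have hq0 : 0 < q := Real.sqrt_pos.2 hv
  have hv2 : v = q ^ 2 := (Real.sq_sqrt hv.le).symm
  have hr : |ξ / s| ≤ 1 := by
    rw [abs_div, abs_of_pos (by linarith : 0 < s)]
    exact div_le_one_of_le₀ hξ.le (by linarith)
  have h1 : |u - c * (ξ / s)| ≤ N / 2 + (-ξ + s) / s * u := by
    have e1 : u - c * (ξ / s) = (-ξ + s) / s * u + -(N / 2 * (ξ / s)) := by
      rw [hc]; field_simp; ring
    have e2 : 0 ≤ (-ξ + s) / s * u :=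
      mul_nonneg (div_nonneg (by linarith [le_abs_self ξ]) (by linarith)) hu
    rw [e1, add_comm (N / 2)]
    refine (abs_add_le _ _).trans (add_le_add (abs_of_nonneg e2).le ?_)
    rw [abs_neg, abs_mul, abs_of_pos (by positivity)]
    exact mul_le_of_le_one_right (by positivity) hr
  have h2 : |c * (ξ / s) - v * c ^ 2 * ξ| ≤
      1 / 2 * (v * c ^ 2) + 1 / 2 * (c * s * q - 1 / q) ^ 2 := by
    have e1 : c * (ξ / s) - v * c ^ 2 * ξ = -(ξ / s) * (c * q * (c * s * q - 1 / q)) := by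
      rw [hv2]; field_simp; ring
    rw [e1, abs_mul, abs_neg]
    refine (mul_le_of_le_one_left (abs_nonneg _) hr).trans ?_
    rw [hv2, abs_mul]
    have := two_mul_le_add_sq |c * q| |c * s * q - 1 / q|
    rw [sq_abs, sq_abs] at this
    nlinarith
  have h3 := abs_add_le (u - c * (ξ / s)) (c * (ξ / s) - v * c ^ 2 * ξ)
  rw [sub_add_sub_cancel] at h3
  linarith

theorem lintegral_error_mul_sitePDF_le (hN : 0 < N) (hy : 1 ≤ y) :
    ∫⁻ u, ∫⁻ v, ENNReal.ofReal |u - v * (N / 2 + u) ^ 2 * ξ| * sitePDF N y ξ u v ≤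
      ENNReal.ofReal (N + y + 3) := by
  have hs := two_le_sqrt_sq_add_four ξ
  have hr := rate_pos ξ
  have hy0 : (0 : ℝ) ≤ y := Nat.cast_nonneg y
  refine lintegral_sitePDF_le hy
    -- The bound of `abs_sub_weight_mul_le` averaged over `v`: `3` is half of the second-moment
    -- bound `6`, and the factor `-ξ + √(ξ² + 4)` in `k₁` cancels the gamma rate.
    (k₀ := N / 2 + 1 / 2 * (N / 2 / √(ξ ^ 2 + 4)) + 3)
    (k₁ := (-ξ + √(ξ ^ 2 + 4)) / √(ξ ^ 2 + 4) + 1 / 2 * (1 / √(ξ ^ 2 + 4)))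
    (by positivity) (by positivity) ?_ fun u hu => ?_
  · have h1 := mean_div_sqrt_le y ξ
    have h2 : N / 2 / √(ξ ^ 2 + 4) ≤ N / 4 := by
      rw [div_le_iff₀ (by positivity)]
      nlinarith
    have h3 : (-ξ + √(ξ ^ 2 + 4)) / √(ξ ^ 2 + 4) * (y / (-ξ + √(ξ ^ 2 + 4))) ≤ y / 2 := by
      have e : (-ξ + √(ξ ^ 2 + 4)) / √(ξ ^ 2 + 4) * (y / (-ξ + √(ξ ^ 2 + 4))) =
          y / √(ξ ^ 2 + 4) := by field_simp
      rw [e]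
      gcongr
    nlinarith
  · have hc : 0 < N / 2 + u := by positivity
    have hcs : 0 < (N / 2 + u) * √(ξ ^ 2 + 4) := by positivity
    set s := √(ξ ^ 2 + 4) with hsdef
    set c := N / 2 + u with hcdef
    obtain ⟨m₀, hm₀⟩ : ∃ m, m = N / 2 + (-ξ + s) / s * u := ⟨_, rfl⟩
    have hm₀0 : 0 ≤ m₀ := by rw [hm₀]; positivity
    have hmI : Measurable (invGaussPDF (1 / (c * s)) 1) :=
      (measurable_invGaussPDF₂ 1).comp (Measurable.prodMk measurable_const measurable_id)
    calc ∫⁻ v, ENNReal.ofReal |u - v * c ^ 2 * ξ| * invGaussPDF (1 / (c * s)) 1 v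
        ≤ ∫⁻ v, (ENNReal.ofReal m₀ * invGaussPDF (1 / (c * s)) 1 v +
            ENNReal.ofReal (1 / 2 * c ^ 2) * (ENNReal.ofReal v * invGaussPDF (1 / (c * s)) 1 v) +
            ENNReal.ofReal (1 / 2) * (ENNReal.ofReal ((c * s * √v - 1 / √v) ^ 2) *
              invGaussPDF (1 / (c * s)) 1 v)) := by
          refine lintegral_mono fun v => ?_
          rcases le_or_gt v 0 with hv | hv
          · simp [invGaussPDF_of_nonpos hv]
          · rw [← mul_assoc, ← mul_assoc, ← add_mul, ← add_mul,
              ← ENNReal.ofReal_mul (by positivity), ← ENNReal.ofReal_mul (by positivity),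
              ← ENNReal.ofReal_add (by positivity) (by positivity),
              ← ENNReal.ofReal_add (by positivity) (by positivity)]
            gcongr
            have := abs_sub_weight_mul_le hN hu hv ξ
            rw [← hsdef, ← hcdef, ← hm₀] at this
            linarith
      _ ≤ ENNReal.ofReal m₀ + ENNReal.ofReal (1 / 2 * c ^ 2) * ENNReal.ofReal (1 / (c * s)) +
            ENNReal.ofReal (1 / 2) * ENNReal.ofReal 6 := by
          rw [lintegral_add_left (by fun_prop), lintegral_add_left (by fun_prop),
            lintegral_const_mul' _ _ ENNReal.ofReal_ne_top,
            lintegral_const_mul' _ _ ENNReal.ofReal_ne_top,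
            lintegral_const_mul' _ _ ENNReal.ofReal_ne_top, lintegral_invGaussPDF hcs,
            lintegral_ofReal_mul_invGaussPDF hcs, mul_one]
          gcongr
          exact lintegral_sq_mul_invGaussPDF_le hcs
      _ = ENNReal.ofReal (m₀ + 1 / 2 * c ^ 2 * (1 / (c * s)) + 1 / 2 * 6) := by
          rw [ENNReal.ofReal_add (by positivity) (by norm_num),
            ENNReal.ofReal_add hm₀0 (by positivity), ENNReal.ofReal_mul (p := 1 / 2 * c ^ 2)
              (by positivity),
            ENNReal.ofReal_mul (p := 1 / 2) (q := 6) (by norm_num)]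
      _ = _ := by
          congr 1
          rw [hm₀, hcdef]
          field_simp
          ring

/-- The part of the density of `(u, v)` that does not involve the linear predictor. -/
noncomputable def siteBase (N : ℝ) (y : ℕ) (u v : ℝ) : ℝ :=
  u ^ ((y : ℝ) - 1) / Real.Gamma y * √(1 / (2 * Real.pi)) * (1 / v ^ (3 / 2 : ℝ)) *
    Real.exp (-2 * (v * (N / 2 + u) ^ 2) - 1 / (2 * v))

theorem siteBase_nonneg {u v : ℝ} (hy : 1 ≤ y) (hu : 0 ≤ u) (hv : 0 < v) :
    0 ≤ siteBase N y u v := by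
  have : 0 < Real.Gamma y := Real.Gamma_pos_of_pos (by exact_mod_cast hy)
  unfold siteBase
  positivity

theorem siteBase_pos {u v : ℝ} (hy : 1 ≤ y) (hu : 0 < u) (hv : 0 < v) :
    0 < siteBase N y u v := by
  have : 0 < Real.Gamma y := Real.Gamma_pos_of_pos (by exact_mod_cast hy)
  unfold siteBase
  positivity

/-- In the exponent, `-s u` from the gamma density cancels against `s (N / 2 + u)` from the inverse
Gaussian, and `s² = ξ² + 4` leaves a form quadratic in `ξ` plus `N s / 2`. -/
theorem sitePDF_eq (hN : 0 < N) {u v : ℝ} (hu : 0 ≤ u) (hv : 0 < v) :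
    sitePDF N y ξ u v = ENNReal.ofReal ((-ξ + √(ξ ^ 2 + 4)) ^ y * siteBase N y u v *
      Real.exp (u * ξ + N / 2 * √(ξ ^ 2 + 4) - 1 / 2 * (v * (N / 2 + u) ^ 2 * ξ ^ 2))) := by
  have hr := rate_pos ξ
  have hs := two_le_sqrt_sq_add_four ξ
  have hs2 : √(ξ ^ 2 + 4) ^ 2 = ξ ^ 2 + 4 := Real.sq_sqrt (by positivity)
  have hc : 0 < N / 2 + u := by positivity
  set s := √(ξ ^ 2 + 4) with hsdef
  rw [sitePDF, ← hsdef, gammaPDF, invGaussPDF, if_pos hv, ENNReal.ofReal_mul' (by positivity)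
    |>.symm, gammaPDFReal, if_pos hu, Real.rpow_natCast]
  congr 1
  have e : Real.exp (-((-ξ + s) * u)) * (Real.exp (1 / (1 / ((N / 2 + u) * s))) *
      Real.exp (-(1 / 2) * (1 / (1 / ((N / 2 + u) * s)) ^ 2 * v + 1 / v))) =
      Real.exp (-2 * (v * (N / 2 + u) ^ 2) - 1 / (2 * v)) *
      Real.exp (u * ξ + N / 2 * s - 1 / 2 * (v * (N / 2 + u) ^ 2 * ξ ^ 2)) := by
    rw [← Real.exp_add, ← Real.exp_add, ← Real.exp_add]
    congr 1
    have e1 : 1 / (1 / ((N / 2 + u) * s)) = (N / 2 + u) * s := one_div_one_div _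
    have e2 : 1 / (1 / ((N / 2 + u) * s)) ^ 2 = (N / 2 + u) ^ 2 * (ξ ^ 2 + 4) := by
      rw [_root_.one_div_pow, one_div_one_div, mul_pow, hs2]
    rw [e1, e2]
    have e3 : 1 / (2 * v) = 1 / 2 * (1 / v) := by field_simp
    rw [e3]
    ring
  unfold siteBase
  linear_combination ((-ξ + s) ^ y / Real.Gamma y * u ^ ((y : ℝ) - 1) * √(1 / (2 * Real.pi)) *
    (1 / v ^ (3 / 2 : ℝ))) * e

/-- A positive continuous function on a compact set; the box `[1, 2]²` avoids the singularities at
`u = 0` and `v = 0`. -/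
theorem exists_le_sitePDF (hN : 0 < N) (hy : 1 ≤ y) (B : ℝ) :
    ∃ δ, 0 < δ ∧ ∀ ξ u v, |ξ| ≤ B → u ∈ Set.Icc (1 : ℝ) 2 → v ∈ Set.Icc (1 : ℝ) 2 →
      ENNReal.ofReal δ ≤ sitePDF N y ξ u v := by
  let f : ℝ × ℝ × ℝ → ℝ := fun q => (-q.1 + √(q.1 ^ 2 + 4)) ^ y * siteBase N y q.2.1 q.2.2 *
    Real.exp (q.2.1 * q.1 + N / 2 * √(q.1 ^ 2 + 4) -
      1 / 2 * (q.2.2 * (N / 2 + q.2.1) ^ 2 * q.1 ^ 2))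
  let S : Set (ℝ × ℝ × ℝ) := Set.Icc (-B) B ×ˢ (Set.Icc 1 2 ×ˢ Set.Icc 1 2)
  have hS : IsCompact S := isCompact_Icc.prod (isCompact_Icc.prod isCompact_Icc)
  have hpos : ∀ q ∈ S, 0 < q.2.1 ∧ 0 < q.2.2 := fun q hq =>
    ⟨zero_lt_one.trans_le hq.2.1.1, zero_lt_one.trans_le hq.2.2.1⟩
  have hf : ContinuousOn f S := by
    have h1 : ContinuousOn (fun q : ℝ × ℝ × ℝ => q.2.1 ^ ((y : ℝ) - 1)) S :=
      ContinuousOn.rpow_const (by fun_prop) fun q hq => Or.inl (hpos q hq).1.ne'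
    have h2 : ContinuousOn (fun q : ℝ × ℝ × ℝ => 1 / q.2.2 ^ (3 / 2 : ℝ)) S :=
      continuousOn_const.div
        (ContinuousOn.rpow_const (by fun_prop) fun q hq => Or.inl (hpos q hq).2.ne')
        fun q hq => (Real.rpow_pos_of_pos (hpos q hq).2 _).ne'
    have h3 : ContinuousOn (fun q : ℝ × ℝ × ℝ => 1 / (2 * q.2.2)) S :=
      continuousOn_const.div (by fun_prop) fun q hq => by have := (hpos q hq).2; positivity
    unfold f siteBase
    refine ContinuousOn.mul (ContinuousOn.mul (by fun_prop) (ContinuousOn.mul (ContinuousOn.mul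
      (ContinuousOn.mul (h1.div_const _) continuousOn_const) h2) ?_)) (by fun_prop)
    exact Real.continuous_exp.comp_continuousOn (ContinuousOn.sub (by fun_prop) h3)
  have hfpos : ∀ q ∈ S, 0 < f q := by
    intro q hq
    have h1 := siteBase_pos (N := N) hy (hpos q hq).1 (hpos q hq).2
    have h2 := rate_pos q.1
    unfold f
    positivity
  obtain ⟨δ, hδ, hle⟩ := hS.exists_forall_le' hf hfpos
  refine ⟨δ, hδ, fun ξ u v hξ hu hv => ?_⟩
  rw [sitePDF_eq hN (zero_le_one.trans hu.1) (zero_lt_one.trans_le hv.1)]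
  exact ENNReal.ofReal_le_ofReal (hle (ξ, u, v) ⟨abs_le.1 hξ, hu, hv⟩)

end Site


/-! ### All latent variables jointly -/

section Latent

variable {n p : ℕ} {X : Matrix (Fin n) (Fin p) ℝ} {N : Fin n → ℝ} {y : Fin n → ℕ}

theorem lintegral_prod_fin_prod (f : Fin n → ℝ → ℝ → ℝ≥0∞)
    (hf : ∀ i, Measurable (Function.uncurry (f i))) :
    ∫⁻ z : (Fin n → ℝ) × (Fin n → ℝ), ∏ i, f i (z.1 i) (z.2 i) = ∏ i, ∫⁻ u, ∫⁻ v, f i u v := by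
  have hm : Measurable fun z : (Fin n → ℝ) × (Fin n → ℝ) => ∏ i, f i (z.1 i) (z.2 i) :=
    Finset.measurable_prod _ fun i _ =>
      (hf i).comp (f := fun z : (Fin n → ℝ) × (Fin n → ℝ) => (z.1 i, z.2 i)) (by fun_prop)
  rw [Measure.volume_eq_prod, lintegral_prod _ hm.aemeasurable]
  simp only
  rw [← lintegral_fin_prod (fun i u => ∫⁻ v, f i u v) fun i => (hf i).lintegral_prod_right']
  exact lintegral_congr fun u => lintegral_fin_prod (fun i => f i (u i)) fun i =>
    (hf i).of_uncurry_left

/-- Absorb `h` into the `i`-th factor of the product density; all other factors integrate to `1`. -/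
theorem lintegral_coord_mul_latentPDF (hN : ∀ i, 0 < N i) (hy : ∀ i, 1 ≤ y i) (β : Fin p → ℝ)
    {h : ℝ → ℝ → ℝ≥0∞} (hh : Measurable (Function.uncurry h)) (i : Fin n) :
    ∫⁻ z, h (z.1 i) (z.2 i) * latentPDF X N y β z =
      ∫⁻ u, ∫⁻ v, h u v * sitePDF (N i) (y i) ((X *ᵥ β) i) u v := by
  let f : Fin n → ℝ → ℝ → ℝ≥0∞ := fun j => sitePDF (N j) (y j) ((X *ᵥ β) j)
  have hf : ∀ j, Measurable (Function.uncurry (f j)) := fun j => measurable_sitePDF _ _ _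
  let g : Fin n → ℝ → ℝ → ℝ≥0∞ := Function.update f i fun u v => h u v * f i u v
  have hgi : g i = fun u v => h u v * f i u v := Function.update_self ..
  have hgj : ∀ j, j ≠ i → g j = f j := fun j hj => Function.update_of_ne hj ..
  have hg : ∀ j, Measurable (Function.uncurry (g j)) := by
    intro j
    by_cases hj : j = i
    · subst hj
      rw [hgi]
      exact hh.mul (hf j)
    · rw [hgj j hj]
      exact hf j
  have h1 : ∀ z : (Fin n → ℝ) × (Fin n → ℝ),
      h (z.1 i) (z.2 i) * latentPDF X N y β z = ∏ j, g j (z.1 j) (z.2 j) := by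
    intro z
    change _ * ∏ j, f j (z.1 j) (z.2 j) = _
    rw [← Finset.mul_prod_erase _ _ (Finset.mem_univ i), ← mul_assoc,
      ← Finset.mul_prod_erase _ (fun j => g j (z.1 j) (z.2 j)) (Finset.mem_univ i), hgi]
    congr 1
    exact Finset.prod_congr rfl fun j hj => by rw [hgj j (Finset.ne_of_mem_erase hj)]
  simp_rw [h1]
  rw [lintegral_prod_fin_prod g hg, ← Finset.mul_prod_erase _ _ (Finset.mem_univ i), hgi,
    Finset.prod_eq_one fun j hj => ?_, mul_one]
  rw [hgj j (Finset.ne_of_mem_erase hj)]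
  exact lintegral_sitePDF (hN j) (hy j)

theorem lintegral_latentPDF (hN : ∀ i, 0 < N i) (hy : ∀ i, 1 ≤ y i) (β : Fin p → ℝ) :
    ∫⁻ z, latentPDF X N y β z = 1 := by
  change ∫⁻ z : (Fin n → ℝ) × (Fin n → ℝ),
    ∏ i, sitePDF (N i) (y i) ((X *ᵥ β) i) (z.1 i) (z.2 i) = 1
  rw [lintegral_prod_fin_prod _ fun j => measurable_sitePDF _ _ _]
  exact Finset.prod_eq_one fun j _ => lintegral_sitePDF (hN j) (hy j)

/-- Outside this set the weights may be negative and the Gaussian step need not be a probability;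
such `z` are discarded because they carry no density. -/
theorem latentPDF_eq_zero {β : Fin p → ℝ} {z : (Fin n → ℝ) × (Fin n → ℝ)}
    (hz : ¬ ∀ i, 0 ≤ z.1 i ∧ 0 < z.2 i) : latentPDF X N y β z = 0 := by
  push Not at hz
  obtain ⟨i, hi⟩ := hz
  refine Finset.prod_eq_zero (Finset.mem_univ i) ?_
  change sitePDF (N i) (y i) ((X *ᵥ β) i) (z.1 i) (z.2 i) = 0
  rcases lt_or_ge (z.1 i) 0 with h | h
  · exact sitePDF_of_neg h
  · exact sitePDF_of_nonpos (hi h)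

theorem weight_nonneg {z : (Fin n → ℝ) × (Fin n → ℝ)} (hz : ∀ i, 0 ≤ z.1 i ∧ 0 < z.2 i)
    (i : Fin n) : 0 ≤ weight N z i :=
  mul_nonneg (hz i).2.le (sq_nonneg _)

end Latent

/-! ### Drift and minorization for the sampler -/

section Sweep

variable {n p : ℕ} {X : Matrix (Fin n) (Fin p) ℝ} {N : Fin n → ℝ} {y : Fin n → ℕ}
  {Ψ : Matrix (Fin p) (Fin p) ℝ} {μ : Fin p → ℝ}

theorem measurable_coefPDF_right (z : (Fin n → ℝ) × (Fin n → ℝ)) :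
    Measurable (coefPDF X N μ Ψ z) :=
  (measurable_coefPDF X N μ Ψ).of_uncurry_left

theorem measurable_latentPDF_right (β : Fin p → ℝ) : Measurable (latentPDF X N y β) :=
  (measurable_latentPDF X N y).of_uncurry_left

theorem coefKernel_univ (hΨ : Ψ.PosDef) {z : (Fin n → ℝ) × (Fin n → ℝ)}
    (hz : ∀ i, 0 ≤ z.1 i ∧ 0 < z.2 i) : coefKernel X N μ Ψ z Set.univ = 1 := by
  rw [coefKernel_apply, withDensity_apply _ MeasurableSet.univ, Measure.restrict_univ]
  exact lintegral_normalPDF (posDef_condPrec X N z hΨ (weight_nonneg hz)) _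

theorem gibbsKernel_apply {A : Set (Fin p → ℝ)} (hA : MeasurableSet A) (β : Fin p → ℝ) :
    gibbsKernel X N y μ Ψ β A = ∫⁻ z, latentPDF X N y β z * coefKernel X N μ Ψ z A := by
  rw [gibbsKernel, Kernel.comp_apply' _ _ _ hA, latentKernel_apply,
    lintegral_withDensity_eq_lintegral_mul _ (measurable_latentPDF_right β)
      (Kernel.measurable_coe _ hA)]
  rfl

theorem isMarkovKernel_gibbsKernel (hN : ∀ i, 0 < N i) (hΨ : Ψ.PosDef) (hy : ∀ i, 1 ≤ y i) :
    IsMarkovKernel (gibbsKernel X N y μ Ψ) := by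
  refine ⟨fun β => ⟨?_⟩⟩
  rw [gibbsKernel_apply MeasurableSet.univ, ← lintegral_latentPDF (X := X) hN hy β]
  refine lintegral_congr fun z => ?_
  by_cases hz : ∀ i, 0 ≤ z.1 i ∧ 0 < z.2 i
  · rw [coefKernel_univ hΨ hz, mul_one]
  · rw [latentPDF_eq_zero hz, zero_mul]

theorem exists_drift (hN : ∀ i, 0 < N i) (hΨ : Ψ.PosDef) (hy : ∀ i, 1 ≤ y i) :
    ∃ γ b : ℝ, 0 ≤ γ ∧ γ < 1 ∧ 0 ≤ b ∧ ∀ β, ∫⁻ β', ENNReal.ofReal (wnorm Ψ β')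
      ∂(gibbsKernel X N y μ Ψ β) ≤ ENNReal.ofReal (γ * wnorm Ψ β + b) := by
  obtain ⟨K, hK, hX⟩ := exists_abs_mulVec_le hΨ X
  have hN' : ∀ i, 0 ≤ N i := fun i => (hN i).le
  -- Bounds the mean of `K² ∑ w i` and is the point of tangency in `wnorm_condMean_le`.
  set A := K ^ 2 * ∑ i, (N i / 4 + (y i : ℝ) / 2) with hAdef
  have hS : 0 ≤ ∑ i, (N i / 4 + (y i : ℝ) / 2) := Finset.sum_nonneg fun i _ => by
    have := hN' i; positivity
  have hA : 0 ≤ A := mul_nonneg (sq_nonneg K) hS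
  have hE : 0 ≤ ∑ i, (N i + (y i : ℝ) + 3) := Finset.sum_nonneg fun i _ => by
    have := hN' i; positivity
  set b₀ := wnorm Ψ μ + K * ∑ i, N i / 2 + √(2 ^ p) with hb₀
  have hb₀0 : 0 ≤ b₀ := add_nonneg (add_nonneg (wnorm_nonneg _) (mul_nonneg hK
    (Finset.sum_nonneg fun i _ => by have := hN' i; positivity))) (Real.sqrt_nonneg _)
  refine ⟨A / (1 + A), b₀ + K * ∑ i, (N i + (y i : ℝ) + 3), by positivity,
    (div_lt_one (by positivity)).2 (by linarith), add_nonneg hb₀0 (mul_nonneg hK hE),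
    fun β => ?_⟩
  have hV := wnorm_nonneg (Ψ := Ψ) β
  -- The bound for the conditional mean, plus Gaussian noise, sorted into a constant `k₀`, a
  -- multiple `k₁` of the total weight, and `K` times the errors.
  set k₀ := A ^ 2 / (1 + A) ^ 2 * wnorm Ψ β + b₀ with hk₀
  set k₁ := K ^ 2 / (1 + A) ^ 2 * wnorm Ψ β with hk₁
  have hk₀0 : 0 ≤ k₀ := by positivity
  have hk₁0 : 0 ≤ k₁ := by positivity
  have hVm : Measurable fun β : Fin p → ℝ => ENNReal.ofReal (wnorm Ψ β) :=
    (measurable_wnorm Ψ).ennreal_ofReal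
  have hL := measurable_latentPDF_right (X := X) (N := N) (y := y) β
  have hw : ∀ i, Measurable fun z : (Fin n → ℝ) × (Fin n → ℝ) =>
      ENNReal.ofReal (z.2 i * (N i / 2 + z.1 i) ^ 2) := fun i => by fun_prop
  have he : ∀ i, Measurable fun z : (Fin n → ℝ) × (Fin n → ℝ) =>
      ENNReal.ofReal |z.1 i - z.2 i * (N i / 2 + z.1 i) ^ 2 * (X *ᵥ β) i| := fun i =>
    (continuous_abs.measurable.comp (by fun_prop : Measurable
      fun z : (Fin n → ℝ) × (Fin n → ℝ) =>
        z.1 i - z.2 i * (N i / 2 + z.1 i) ^ 2 * (X *ᵥ β) i)).ennreal_ofReal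
  have hwL : ∀ i, Measurable fun z => ENNReal.ofReal (z.2 i * (N i / 2 + z.1 i) ^ 2) *
      latentPDF X N y β z := fun i => (hw i).mul hL
  have heL : ∀ i, Measurable fun z =>
      ENNReal.ofReal |z.1 i - z.2 i * (N i / 2 + z.1 i) ^ 2 * (X *ᵥ β) i| *
        latentPDF X N y β z := fun i => (he i).mul hL
  have hpoint : ∀ z, latentPDF X N y β z *
      ∫⁻ β', ENNReal.ofReal (wnorm Ψ β') ∂(coefKernel X N μ Ψ z) ≤
      ENNReal.ofReal k₀ * latentPDF X N y β z +
      ENNReal.ofReal k₁ * ∑ i, ENNReal.ofReal (z.2 i * (N i / 2 + z.1 i) ^ 2) *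
        latentPDF X N y β z +
      ENNReal.ofReal K * ∑ i, ENNReal.ofReal |z.1 i - z.2 i * (N i / 2 + z.1 i) ^ 2 *
        (X *ᵥ β) i| * latentPDF X N y β z := by
    intro z
    by_cases hz : ∀ i, 0 ≤ z.1 i ∧ 0 < z.2 i
    · have hwz := weight_nonneg (N := N) hz
      have hwz' : ∀ i, 0 ≤ z.2 i * (N i / 2 + z.1 i) ^ 2 := hwz
      rw [← Finset.sum_mul, ← Finset.sum_mul, ← mul_assoc, ← mul_assoc, ← add_mul, ← add_mul,
        mul_comm]
      gcongr
      rw [← ENNReal.ofReal_sum_of_nonneg fun i _ => hwz' i,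
        ← ENNReal.ofReal_sum_of_nonneg fun i _ => abs_nonneg _, ← ENNReal.ofReal_mul hk₁0,
        ← ENNReal.ofReal_mul hK,
        ← ENNReal.ofReal_add hk₀0 (mul_nonneg hk₁0 (Finset.sum_nonneg fun i _ => hwz' i)),
        ← ENNReal.ofReal_add
          (add_nonneg hk₀0 (mul_nonneg hk₁0 (Finset.sum_nonneg fun i _ => hwz' i)))
          (mul_nonneg hK (Finset.sum_nonneg fun i _ => abs_nonneg _)),
        coefKernel_apply, lintegral_withDensity_eq_lintegral_mul _ (measurable_coefPDF_right z) hVm]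
      simp only [Pi.mul_apply, mul_comm (coefPDF X N μ Ψ z _)]
      refine (lintegral_wnorm_normalPDF_le hΨ (posDef_condPrec X N z hΨ hwz)
        (quadForm_le_condPrec X N z hwz) _).trans (ENNReal.ofReal_le_ofReal ?_)
      have h1 := wnorm_condMean_le hΨ hN hwz hK hX μ β hA
      rw [Finset.sum_add_distrib] at h1
      refine (add_le_add_left h1 _).trans (le_of_eq ?_)
      rw [hk₀, hk₁, hb₀]
      simp only [weight]
      ring
    · simp [latentPDF_eq_zero hz]
  rw [gibbsKernel, Kernel.lintegral_comp _ _ _ hVm, latentKernel_apply,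
    lintegral_withDensity_eq_lintegral_mul _ hL hVm.lintegral_kernel]
  refine (lintegral_mono hpoint).trans ?_
  rw [lintegral_add_left (by fun_prop), lintegral_add_left (by fun_prop),
    lintegral_const_mul' _ _ ENNReal.ofReal_ne_top, lintegral_const_mul' _ _ ENNReal.ofReal_ne_top,
    lintegral_const_mul' _ _ ENNReal.ofReal_ne_top, lintegral_latentPDF hN hy,
    lintegral_finsetSum _ fun i _ => hwL i, lintegral_finsetSum _ fun i _ => heL i]
  have h2 : ∀ i, ∫⁻ z, ENNReal.ofReal (z.2 i * (N i / 2 + z.1 i) ^ 2) * latentPDF X N y β z ≤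
      ENNReal.ofReal (N i / 4 + y i / 2) := fun i =>
    (lintegral_coord_mul_latentPDF hN hy β
      (h := fun u v => ENNReal.ofReal (v * (N i / 2 + u) ^ 2))
      (by unfold Function.uncurry; fun_prop) i).le.trans
      (lintegral_weight_mul_sitePDF_le (hN i) (hy i))
  have h3 : ∀ i, ∫⁻ z, ENNReal.ofReal |z.1 i - z.2 i * (N i / 2 + z.1 i) ^ 2 * (X *ᵥ β) i| *
      latentPDF X N y β z ≤ ENNReal.ofReal (N i + y i + 3) := fun i =>
    (lintegral_coord_mul_latentPDF hN hy β
      (h := fun u v => ENNReal.ofReal |u - v * (N i / 2 + u) ^ 2 * (X *ᵥ β) i|)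
      (continuous_abs.measurable.comp (by fun_prop : Measurable
        fun q : ℝ × ℝ => q.1 - q.2 * (N i / 2 + q.1) ^ 2 * (X *ᵥ β) i)).ennreal_ofReal i).le.trans
      (lintegral_error_mul_sitePDF_le (hN i) (hy i))
  calc _ ≤ ENNReal.ofReal k₀ * 1 + ENNReal.ofReal k₁ * ∑ i, ENNReal.ofReal (N i / 4 + y i / 2) +
        ENNReal.ofReal K * ∑ i, ENNReal.ofReal (N i + y i + 3) := by
        gcongr with i _ i _
        · exact h2 i
        · exact h3 i
    _ = ENNReal.ofReal (k₀ + k₁ * ∑ i, (N i / 4 + (y i : ℝ) / 2) +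
        K * ∑ i, (N i + (y i : ℝ) + 3)) := by
        rw [mul_one, ← ENNReal.ofReal_sum_of_nonneg fun i _ => by have := hN' i; positivity,
          ← ENNReal.ofReal_sum_of_nonneg fun i _ => by have := hN' i; positivity,
          ← ENNReal.ofReal_mul hk₁0, ← ENNReal.ofReal_mul hK,
          ← ENNReal.ofReal_add hk₀0 (mul_nonneg hk₁0 hS),
          ← ENNReal.ofReal_add (add_nonneg hk₀0 (mul_nonneg hk₁0 hS)) (mul_nonneg hK hE)]
    _ = _ := by
        congr 1
        -- The tangent meets the curve at `A`: `(A² + A) / (1 + A)² = A / (1 + A)`.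
        have h4 : k₁ * ∑ i, (N i / 4 + (y i : ℝ) / 2) = A / (1 + A) ^ 2 * wnorm Ψ β := by
          rw [hk₁, hAdef]; ring
        rw [h4, hk₀]
        have h5 : 1 + A ≠ 0 := by positivity
        field_simp
        ring

theorem exists_minorization (hN : ∀ i, 0 < N i) (hΨ : Ψ.PosDef) (hy : ∀ i, 1 ≤ y i) (R : ℝ) :
    ∃ ν : Measure (Fin p → ℝ), IsFiniteMeasure ν ∧ ν Set.univ ≠ 0 ∧
      ∀ β, wnorm Ψ β ≤ R → ν ≤ gibbsKernel X N y μ Ψ β := by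
  obtain ⟨K, hK, hX⟩ := exists_abs_mulVec_le hΨ X
  choose δ hδ0 hδ using fun i => exists_le_sitePDF (hN i) (hy i) (K * R)
  -- This box has volume `1`, so the minorant built from it has mass exactly `c`.
  set S : Set ((Fin n → ℝ) × (Fin n → ℝ)) :=
    Set.Icc (fun _ => 1) (fun _ => 2) ×ˢ Set.Icc (fun _ => 1) (fun _ => 2) with hS
  have hSm : MeasurableSet S := measurableSet_Icc.prod measurableSet_Icc
  have hSvol : volume S = 1 := by
    rw [hS, Measure.volume_eq_prod, Measure.prod_prod, Real.volume_Icc_pi]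
    norm_num
  set c : ℝ≥0∞ := ∏ i, ENNReal.ofReal (δ i) with hc
  have hc0 : c ≠ 0 := Finset.prod_ne_zero_iff.2 fun i _ => (ENNReal.ofReal_pos.2 (hδ0 i)).ne'
  have hct : c ≠ ∞ := ENNReal.prod_ne_top fun i _ => ENNReal.ofReal_ne_top
  have huniv : ((c • volume.restrict S).bind (coefKernel X N μ Ψ)) Set.univ = c := by
    rw [Measure.bind_apply MeasurableSet.univ (Kernel.aemeasurable _), lintegral_smul_measure,
      setLIntegral_congr_fun (g := fun _ => 1) hSm fun z hz => coefKernel_univ hΨ fun i =>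
        ⟨zero_le_one.trans (hz.1.1 i), zero_lt_one.trans_le (hz.2.1 i)⟩]
    simp [hSvol]
  refine ⟨(c • volume.restrict S).bind (coefKernel X N μ Ψ), ⟨?_⟩, ?_, fun β hβ => ?_⟩
  · rw [huniv]; exact hct.lt_top
  · rw [huniv]; exact hc0
  have hle : c • volume.restrict S ≤ latentKernel X N y β := by
    refine Measure.le_iff.2 fun B hB => ?_
    rw [latentKernel_apply, withDensity_apply _ hB, Measure.smul_apply, Measure.restrict_apply hB,
      smul_eq_mul, ← setLIntegral_const]
    refine le_trans (setLIntegral_mono' (hB.inter hSm) fun z hz => ?_)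
      (lintegral_mono_set Set.inter_subset_left)
    refine Finset.prod_le_prod' fun i _ => hδ i _ _ _ ?_ ⟨hz.2.1.1 i, hz.2.1.2 i⟩
      ⟨hz.2.2.1 i, hz.2.2.2 i⟩
    exact (hX β i).trans (by gcongr)
  refine Measure.le_iff.2 fun B hB => ?_
  rw [Measure.bind_apply hB (Kernel.aemeasurable _), gibbsKernel, Kernel.comp_apply' _ _ _ hB]
  exact lintegral_mono' hle le_rfl

end Sweep


/-! ### The posterior and its invariance -/

section Posterior

variable {n p : ℕ} {X : Matrix (Fin n) (Fin p) ℝ} {N : Fin n → ℝ} {y : Fin n → ℕ}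
  {Ψ : Matrix (Fin p) (Fin p) ℝ} {μ : Fin p → ℝ}

theorem link_pos (ξ : ℝ) : 0 < link ξ := by
  have := abs_lt_sqrt_sq_add_four ξ
  have := neg_abs_le ξ
  exact div_pos (by linarith) two_pos

theorem poissonMeasure_link_singleton {N : ℝ} (hN : 0 < N) (y : ℕ) (ξ : ℝ) :
    poissonMeasure (Real.toNNReal (N * link ξ)) {y} =
      ENNReal.ofReal (Real.exp (-(N * link ξ)) * (N * link ξ) ^ y / y.factorial) := by
  rw [poissonMeasure_singleton, Real.coe_toNNReal _ (mul_pos hN (link_pos ξ)).le]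

theorem measurable_likelihood (hN : ∀ i, 0 < N i) : Measurable (likelihood X N y) := by
  unfold likelihood
  refine Finset.measurable_prod _ fun i _ => ?_
  simp_rw [fun β => poissonMeasure_link_singleton (hN i) (y i) ((X *ᵥ β) i)]
  unfold link
  simp only [mulVec, dotProduct]
  fun_prop

theorem likelihood_le_one (β : Fin p → ℝ) : likelihood X N y β ≤ 1 :=
  Finset.prod_le_one' fun _ _ => prob_le_one

theorem likelihood_pos (hN : ∀ i, 0 < N i) (β : Fin p → ℝ) : 0 < likelihood X N y β := by
  refine pos_iff_ne_zero.2 (Finset.prod_ne_zero_iff.2 fun i _ => ?_)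
  rw [poissonMeasure_link_singleton (hN i)]
  have := mul_pos (hN i) (link_pos ((X *ᵥ β) i))
  exact (ENNReal.ofReal_pos.2 (by positivity)).ne'

theorem normalPDF_pos {Q : Matrix (Fin p) (Fin p) ℝ} (hQ : Q.PosDef) (a β : Fin p → ℝ) :
    0 < normalPDF a Q β := by
  have := hQ.det_pos
  exact ENNReal.ofReal_pos.2 (by positivity)

theorem normalizer_ne_top (hΨ : Ψ.PosDef) :
    ∫⁻ β, normalPDF μ Ψ β * likelihood X N y β ≠ ∞ := by
  refine ne_top_of_le_ne_top ENNReal.one_ne_top ?_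
  rw [← lintegral_normalPDF hΨ μ]
  exact lintegral_mono fun β => mul_le_of_le_one_right' (likelihood_le_one β)

theorem normalizer_ne_zero (hN : ∀ i, 0 < N i) (hΨ : Ψ.PosDef) :
    ∫⁻ β, normalPDF μ Ψ β * likelihood X N y β ≠ 0 := by
  have hm := (measurable_normalPDF μ Ψ).mul (measurable_likelihood (X := X) (y := y) hN)
  refine ((lintegral_pos_iff_support hm).2 ?_).ne'
  have : Function.support (normalPDF μ Ψ * likelihood X N y) = Set.univ :=
    Set.eq_univ_of_forall fun β =>
      (ENNReal.mul_pos (normalPDF_pos hΨ μ β).ne' (likelihood_pos hN β).ne').ne'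
  rw [this]
  exact Measure.measure_univ_pos.2 (NeZero.ne _)

theorem isProbabilityMeasure_posterior (hN : ∀ i, 0 < N i) (hΨ : Ψ.PosDef) :
    IsProbabilityMeasure (posterior X N y μ Ψ) := by
  constructor
  rw [posterior, Measure.smul_apply, withDensity_apply _ MeasurableSet.univ, Measure.restrict_univ,
    smul_eq_mul, ENNReal.inv_mul_cancel (normalizer_ne_zero hN hΨ) (normalizer_ne_top hΨ)]

/-- The likelihood is at most `1`, so up to normalization the posterior is dominated by the Gaussian
prior. -/
theorem lintegral_wnorm_posterior_ne_top (hN : ∀ i, 0 < N i) (hΨ : Ψ.PosDef) :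
    ∫⁻ β, ENNReal.ofReal (wnorm Ψ β) ∂(posterior X N y μ Ψ) ≠ ∞ := by
  have hm : Measurable fun β => normalPDF μ Ψ β * likelihood X N y β :=
    (measurable_normalPDF μ Ψ).mul (measurable_likelihood hN)
  rw [posterior, lintegral_smul_measure,
    lintegral_withDensity_eq_lintegral_mul _ hm (measurable_wnorm Ψ).ennreal_ofReal]
  refine ENNReal.mul_ne_top (ENNReal.inv_ne_top.2 (normalizer_ne_zero hN hΨ)) ?_
  refine ne_top_of_le_ne_top ENNReal.ofReal_ne_top (le_trans (lintegral_mono fun β => ?_)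
    (lintegral_wnorm_normalPDF_le hΨ hΨ (fun _ => le_rfl) μ))
  simp only [Pi.mul_apply]
  rw [mul_comm]
  gcongr
  exact mul_le_of_le_one_right' (likelihood_le_one β)

/-- The link is matched to the gamma rate: `link ξ * (-ξ + √(ξ² + 4)) = 2` and `-N link ξ + N √(ξ² +
4) / 2 = -N ξ / 2`. Only a Gaussian factor in `ξ` survives. -/
theorem poisson_mul_sitePDF {N : ℝ} (hN : 0 < N) (y : ℕ) (ξ : ℝ) {u v : ℝ}
    (hu : 0 ≤ u) (hv : 0 < v) :
    poissonMeasure (Real.toNNReal (N * link ξ)) {y} * sitePDF N y ξ u v =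
      ENNReal.ofReal ((2 * N) ^ y / y.factorial * siteBase N y u v *
        Real.exp ((u - N / 2) * ξ - 1 / 2 * (v * (N / 2 + u) ^ 2 * ξ ^ 2))) := by
  have hl := link_pos ξ
  have hs2 : √(ξ ^ 2 + 4) ^ 2 = ξ ^ 2 + 4 := Real.sq_sqrt (by positivity)
  rw [poissonMeasure_link_singleton hN, sitePDF_eq hN hu hv, ← ENNReal.ofReal_mul (by positivity)]
  congr 1
  have h1 : (N * link ξ) ^ y * (-ξ + √(ξ ^ 2 + 4)) ^ y = (2 * N) ^ y := by
    rw [← mul_pow]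
    congr 1
    unfold link
    linear_combination (N / 2) * hs2
  have h2 : Real.exp (-(N * link ξ)) *
      Real.exp (u * ξ + N / 2 * √(ξ ^ 2 + 4) - 1 / 2 * (v * (N / 2 + u) ^ 2 * ξ ^ 2)) =
      Real.exp ((u - N / 2) * ξ - 1 / 2 * (v * (N / 2 + u) ^ 2 * ξ ^ 2)) := by
    rw [← Real.exp_add]
    congr 1
    unfold link
    ring
  rw [← h1, ← h2]
  ring

theorem likelihood_mul_latentPDF (hN : ∀ i, 0 < N i) (hy : ∀ i, 1 ≤ y i) (β : Fin p → ℝ)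
    {z : (Fin n → ℝ) × (Fin n → ℝ)} (hz : ∀ i, 0 ≤ z.1 i ∧ 0 < z.2 i) :
    likelihood X N y β * latentPDF X N y β z =
      ENNReal.ofReal ((∏ i, ((2 * N i) ^ y i / (y i).factorial *
        siteBase (N i) (y i) (z.1 i) (z.2 i))) *
        Real.exp (∑ i, ((z.1 i - N i / 2) * (X *ᵥ β) i -
          1 / 2 * (weight N z i * (X *ᵥ β) i ^ 2)))) := by
  change _ * ∏ i, sitePDF (N i) (y i) ((X *ᵥ β) i) (z.1 i) (z.2 i) = _
  rw [likelihood, ← Finset.prod_mul_distrib, Real.exp_sum, ← Finset.prod_mul_distrib,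
    ENNReal.ofReal_prod_of_nonneg]
  · exact Finset.prod_congr rfl fun i _ => poisson_mul_sitePDF (hN i) _ _ (hz i).1 (hz i).2
  · intro i _
    have := siteBase_nonneg (N := N i) (hy i) (hz i).1 (hz i).2
    have := hN i
    positivity

theorem complete_square (hΨ : Ψ.PosDef) {z : (Fin n → ℝ) × (Fin n → ℝ)}
    (hz : ∀ i, 0 ≤ weight N z i) (β : Fin p → ℝ) :
    -(1 / 2) * ((β - μ) ⬝ᵥ (Ψ *ᵥ (β - μ))) + ∑ i, ((z.1 i - N i / 2) * (X *ᵥ β) i -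
      1 / 2 * (weight N z i * (X *ᵥ β) i ^ 2)) =
    -(1 / 2) * ((β - condMean X N μ Ψ z) ⬝ᵥ
      (condPrec X N Ψ z *ᵥ (β - condMean X N μ Ψ z))) +
      1 / 2 * (condMean X N μ Ψ z ⬝ᵥ (condPrec X N Ψ z *ᵥ condMean X N μ Ψ z) -
        μ ⬝ᵥ (Ψ *ᵥ μ)) := by
  have hQ := posDef_condPrec X N z hΨ hz
  have hu : IsUnit (condPrec X N Ψ z).det := hQ.det_pos.ne'.isUnit
  have hm : condPrec X N Ψ z *ᵥ condMean X N μ Ψ z =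
      Ψ *ᵥ μ + Xᵀ *ᵥ (fun i => z.1 i - N i / 2) := by
    rw [condMean, mulVec_mulVec, mul_nonsing_inv _ hu, one_mulVec]
  have hβm : β ⬝ᵥ (condPrec X N Ψ z *ᵥ condMean X N μ Ψ z) =
      β ⬝ᵥ (Ψ *ᵥ μ) + ∑ i, (z.1 i - N i / 2) * (X *ᵥ β) i := by
    rw [hm, dotProduct_add, dotProduct_mulVec β Xᵀ, vecMul_transpose, dotProduct_comm (X *ᵥ β)]
    rfl
  have hββ := dotProduct_condPrec_mulVec X N z Ψ β β
  set m := condMean X N μ Ψ z with hmdef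
  simp only [mulVec_sub, sub_dotProduct, dotProduct_sub]
  rw [dotProduct_mulVec_comm hΨ μ β, dotProduct_mulVec_comm hQ m β, hβm, hββ,
    Finset.sum_sub_distrib, ← Finset.mul_sum]
  simp only [← sq]
  ring

/-- As a function of `β`, the joint density of `(β, z)` is proportional to the conditional density
of `β` given `z`. -/
theorem exists_joint_eq (hN : ∀ i, 0 < N i) (hΨ : Ψ.PosDef) (hy : ∀ i, 1 ≤ y i)
    {z : (Fin n → ℝ) × (Fin n → ℝ)} (hz : ∀ i, 0 ≤ z.1 i ∧ 0 < z.2 i) :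
    ∃ g : ℝ≥0∞, ∀ β, normalPDF μ Ψ β * likelihood X N y β * latentPDF X N y β z =
      g * coefPDF X N μ Ψ z β := by
  have hwz := weight_nonneg (N := N) hz
  have hQd := (posDef_condPrec X N z hΨ hwz).det_pos
  have hΨd := hΨ.det_pos
  set c := ∏ i, ((2 * N i) ^ y i / (y i).factorial * siteBase (N i) (y i) (z.1 i) (z.2 i)) with hc
  have hc0 : 0 ≤ c := Finset.prod_nonneg fun i _ => by
    have := siteBase_nonneg (N := N i) (hy i) (hz i).1 (hz i).2
    have := hN i
    positivity
  set q := √((condPrec X N Ψ z).det / (2 * Real.pi) ^ p) with hq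
  have hq0 : 0 < q := by positivity
  refine ⟨ENNReal.ofReal (√(Ψ.det / (2 * Real.pi) ^ p) * c * Real.exp (1 / 2 *
    (condMean X N μ Ψ z ⬝ᵥ (condPrec X N Ψ z *ᵥ condMean X N μ Ψ z) - μ ⬝ᵥ (Ψ *ᵥ μ))) / q),
    fun β => ?_⟩
  rw [mul_assoc, likelihood_mul_latentPDF hN hy β hz, coefPDF, normalPDF, normalPDF, ← hc, ← hq,
    ← ENNReal.ofReal_mul (by positivity), ← ENNReal.ofReal_mul (by positivity)]
  congr 1
  have h1 := congrArg Real.exp (complete_square (X := X) (N := N) (μ := μ) hΨ hwz β)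
  rw [Real.exp_add, Real.exp_add] at h1
  have h2 : ∀ a b d e : ℝ, a * c * b / q * (q * d) = a * c * (d * b) := by
    intro a b d e
    field_simp
  -- The last argument of `h2` does not occur in its equation; `0` is a filler.
  rw [h2 _ _ _ 0, ← h1]
  ring

/-- Bayes' rule: the marginal of `z` times the conditional law of `β` is the joint law, as the
proportionality factor depends on `z` alone. -/
theorem lintegral_joint_mul_coefKernel (hN : ∀ i, 0 < N i) (hΨ : Ψ.PosDef) (hy : ∀ i, 1 ≤ y i)
    (z : (Fin n → ℝ) × (Fin n → ℝ)) {A : Set (Fin p → ℝ)} (hA : MeasurableSet A) :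
    (∫⁻ β, normalPDF μ Ψ β * likelihood X N y β * latentPDF X N y β z) *
      coefKernel X N μ Ψ z A =
    ∫⁻ β in A, normalPDF μ Ψ β * likelihood X N y β * latentPDF X N y β z := by
  by_cases hz : ∀ i, 0 ≤ z.1 i ∧ 0 < z.2 i
  · obtain ⟨g, hg⟩ := exists_joint_eq (X := X) (μ := μ) hN hΨ hy hz
    have h1 : ∫⁻ β, coefPDF X N μ Ψ z β = 1 :=
      lintegral_normalPDF (posDef_condPrec X N z hΨ (weight_nonneg hz)) _
    simp_rw [hg]
    rw [lintegral_const_mul _ (measurable_coefPDF_right z),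
      lintegral_const_mul _ (measurable_coefPDF_right z), h1, mul_one, coefKernel_apply,
      withDensity_apply _ hA]
  · simp [latentPDF_eq_zero hz]

/-- Two-block Gibbs: integrate the joint density over `β`, redraw `β` from its conditional law, and
integrate out `z`; Tonelli exchanges the orders. -/
theorem invariant_posterior (hN : ∀ i, 0 < N i) (hΨ : Ψ.PosDef) (hy : ∀ i, 1 ≤ y i) :
    (gibbsKernel X N y μ Ψ).Invariant (posterior X N y μ Ψ) := by
  have hm : Measurable fun β => normalPDF μ Ψ β * likelihood X N y β :=
    (measurable_normalPDF μ Ψ).mul (measurable_likelihood hN)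
  have hL : Measurable fun q : (Fin p → ℝ) × ((Fin n → ℝ) × (Fin n → ℝ)) =>
      latentPDF X N y q.1 q.2 := measurable_latentPDF X N y
  have hJ : Measurable fun q : (Fin p → ℝ) × ((Fin n → ℝ) × (Fin n → ℝ)) =>
      normalPDF μ Ψ q.1 * likelihood X N y q.1 * latentPDF X N y q.1 q.2 :=
    (hm.comp measurable_fst).mul hL
  refine Measure.ext fun A hA => ?_
  have hC : Measurable fun z => coefKernel X N μ Ψ z A := Kernel.measurable_coe _ hA
  rw [Measure.bind_apply hA (Kernel.aemeasurable _), posterior, lintegral_smul_measure,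
    Measure.smul_apply, lintegral_withDensity_eq_lintegral_mul _ hm (Kernel.measurable_coe _ hA),
    withDensity_apply _ hA]
  congr 1
  calc ∫⁻ β, ((fun β => normalPDF μ Ψ β * likelihood X N y β) *
          fun β => gibbsKernel X N y μ Ψ β A) β
      = ∫⁻ β, ∫⁻ z, normalPDF μ Ψ β * likelihood X N y β * latentPDF X N y β z *
          coefKernel X N μ Ψ z A := by
        refine lintegral_congr fun β => ?_
        rw [Pi.mul_apply, gibbsKernel_apply hA,
          ← lintegral_const_mul (f := fun z => latentPDF X N y β z * coefKernel X N μ Ψ z A) _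
            ((measurable_latentPDF_right β).mul hC)]
        simp only [mul_assoc]
    _ = ∫⁻ z, ∫⁻ β, normalPDF μ Ψ β * likelihood X N y β * latentPDF X N y β z *
          coefKernel X N μ Ψ z A :=
        lintegral_lintegral_swap (hJ.mul (hC.comp measurable_snd)).aemeasurable
    _ = ∫⁻ z, ∫⁻ β in A, normalPDF μ Ψ β * likelihood X N y β * latentPDF X N y β z := by
        refine lintegral_congr fun z => ?_
        have hJz : Measurable fun β =>
            normalPDF μ Ψ β * likelihood X N y β * latentPDF X N y β z :=
          hm.mul (measurable_latentPDF X N y).of_uncurry_right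
        rw [lintegral_mul_const _ hJz,
          lintegral_joint_mul_coefKernel hN hΨ hy z hA]
    _ = ∫⁻ β in A, ∫⁻ z, normalPDF μ Ψ β * likelihood X N y β * latentPDF X N y β z :=
        (lintegral_lintegral_swap hJ.aemeasurable).symm
    _ = ∫⁻ β in A, normalPDF μ Ψ β * likelihood X N y β := by
        refine lintegral_congr fun β => ?_
        rw [lintegral_const_mul _ (measurable_latentPDF_right β), lintegral_latentPDF hN hy,
          mul_one]

end Posterior

end PoissonGibbs

theorem theorem1 {n p : ℕ} (X : Matrix (Fin n) (Fin p) ℝ) (N : Fin n → ℝ) (y : Fin n → ℕ)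
    (μ : Fin p → ℝ) (Ψ : Matrix (Fin p) (Fin p) ℝ)
    (hN : ∀ i, 0 < N i) (hΨ : Ψ.PosDef) (hy : ∀ i, 1 ≤ y i) (hX : (Xᵀ * X).rank = p) :
    PoissonGibbs.GeometricallyErgodic (PoissonGibbs.gibbsKernel X N y μ Ψ)
      (PoissonGibbs.posterior X N y μ Ψ) := by
  have h1 := PoissonGibbs.isMarkovKernel_gibbsKernel (X := X) (μ := μ) hN hΨ hy
  have h2 := PoissonGibbs.isProbabilityMeasure_posterior (X := X) (y := y) (μ := μ) hN hΨ
  obtain ⟨γ, b, hγ0, hγ1, hb, hdrift⟩ := PoissonGibbs.exists_drift (X := X) (μ := μ) hN hΨ hy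
  exact PoissonGibbs.geometricallyErgodic_of_drift_of_minorization _ _
    (PoissonGibbs.invariant_posterior hN hΨ hy) (PoissonGibbs.measurable_wnorm Ψ)
    PoissonGibbs.wnorm_nonneg hγ0 hγ1 hb hdrift
    (PoissonGibbs.lintegral_wnorm_posterior_ne_top hN hΨ)
    (PoissonGibbs.exists_minorization hN hΨ hy)
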